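/- Let $\theta\in(0,1]$, let $\lambda:[0,\infty)\to[0,\infty)$ satisfy $\Lambda_t=\int_0^t\lambda_u\,du<\infty$ for all $t\ge 0$, and let $a:[0,\infty)\to[0,1+1/\theta]$ be measurable. Let $(Z_t)_{t\ge0}$ be the theta-positive branching process in the varying environment $(\lambda,a)$, that is, the time-inhomogeneous Markov branching process with $Z_0=1$ in which, at time $t$, each living individual dies at rate $\lambda_t$, independently of the others, and is then replaced by $k$ individuals with probability $p_t(k)$, where $$\sum_{k\ge0}p_t(k)s^k=1-a_t(1-s)+\frac{a_t}{1+\theta}(1-s)^{1+\theta},\qquad 0\le s\le 1 .$$ Put $$\mu_t=\exp\Big\{\int_0^t(a_u-1)\lambda_u\,du\Big\},\qquad V_{t,\theta}=\frac{\theta}{1+\theta}\int_0^t\mu_u^{-\theta}\lambda_u\,du,\qquad V_\theta=\lim_{t\to\infty}V_{t,\theta},\qquad m_t=\mathrm E(Z_t\mid Z_t>0).$$ The process is called loosely subcritical if $\lim_{t\to\infty}\mathrm P(Z_t=0)=1$ and $m_t$ has no limit, finite or infinite, as $t\to\infty$. **Theorem.** The process is loosely subcritical if and only if $V_\theta=\infty$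 and $\mu_t^\theta V_{t,\theta}$ has no limit in $[0,\infty]$ as $t\to\infty$. Suppose that this is the case. Then there are increasing sequences of times tending to infinity along which $\mu_t^\theta V_{t,\theta}$ converges in $[0,\infty]$ to different limits. Moreover, let $t_n\to\infty$ be such that $\mu_{t_n}^\theta V_{t_n,\theta}\to M_\theta\in[0,\infty]$. 1. If $M_\theta=\infty$, then, as $n\to\infty$, $$\mathrm P(Z_{t_n}>0)\sim V_{t_n,\theta}^{-1/\theta},\qquad m_{t_n}\sim\mu_{t_n}V_{t_n,\theta}^{1/\theta},$$ $$\mathrm E\big(e^{-wZ_{t_n}/m_{t_n}}\mid Z_{t_n}>0\big)\to 1-(1+w^{-\theta})^{-1/\theta},\qquad w\ge0,$$ where the right-hand side is $1$ at $w=0$. 2. If $0\le M_\theta<\infty$, put $m=\big(M_\theta+\frac{\theta}{1+\theta}\big)^{1/\theta}$. Then, as $n\to\infty$, $$\mu_{t_n}\to0,\qquad \mathrm P(Z_{t_n}>0)\sim m^{-1}\mu_{t_n},\qquad m_{t_n}\to m,$$ $$\mathrm E\big(s^{Z_{t_n}}\mid Z_{t_n}>0\big)\to 1-m\Big(M_\theta-\frac1{1+\theta}+(1-s)^{-\theta}\Big)^{-1/\theta},\qquad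 0\le s\le1,$$ where the right-hand side is $1$ at $s=1$. -/

import Mathlib

open MeasureTheory ProbabilityTheory Filter Topology Asymptotics
open scoped NNReal ENNReal

noncomputable section

namespace ThetaBranching

/-- The offspring law with parameter `θ ∈ (0,1]` and mean `a ∈ [0, 1 + 1/θ]`:
`p(0) = 1 - θ a / (1 + θ)`, `p(1) = 0` and
`p(n) = θ (1 - θ) (2 - θ) ⋯ (n - 2 - θ) a / n!` for `n ≥ 2`.
Its probability generating function is
`h(s) = 1 - a (1 - s) + a (1 + θ)⁻¹ (1 - s)^(1 + θ)`. -/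
def offspring (θ a : ℝ) : ℕ → ℝ
  | 0 => 1 - θ / (1 + θ) * a
  | 1 => 0
  | n + 2 => θ * (∏ j ∈ Finset.range n, ((j : ℝ) + 1 - θ)) * a / (Nat.factorial (n + 2) : ℝ)

/-- The generator at time `u` of the population size: each of the `i` living individuals dies at
rate `lam u`, independently of the others, and is replaced by `k` individuals with probability
`p_u(k)`, so that the population jumps from `i` to `i - 1 + k` at rate `i * lam u * p_u(k)`.
(For `i = 0` the factor `i` vanishes, so the value of `i + k - 1` does not matter.) -/
def generator (θ : ℝ) (lam a : ℝ → ℝ) (f : ℕ → ℝ) (u : ℝ) (i : ℕ) : ℝ :=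
  (i : ℝ) * lam u * ∑' k : ℕ, offspring θ (a u) k * (f (i + k - 1) - f i)

/-- `lam` and `a` form an admissible environment for the parameter `θ`: a death rate with finite
cumulative hazard `∫₀ᵗ lam` for all `t`, and mean offspring numbers in `[0, 1 + 1/θ]`. -/
structure IsEnvironment (θ : ℝ) (lam a : ℝ → ℝ) : Prop where
  lam_nonneg : ∀ t, 0 ≤ t → 0 ≤ lam t
  lam_integrable : ∀ t, 0 ≤ t → IntervalIntegrable lam volume 0 t
  a_measurable : Measurable a
  a_nonneg : ∀ t, 0 ≤ t → 0 ≤ a t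
  a_le : ∀ t, 0 ≤ t → a t ≤ 1 + 1 / θ

/-- `Z` is a theta-positive branching process in the varying environment `(lam, a)`: a
`ℕ`-valued process with càdlàg paths (so finitely many jumps in bounded time), started from one
individual, that solves the martingale problem of the generator above (on finitely supported
functions, with respect to its own filtration). -/
structure IsProcess {Ω : Type*} [MeasurableSpace Ω] (P : Measure Ω) (θ : ℝ) (lam a : ℝ → ℝ)
    (Z : ℝ≥0 → Ω → ℕ) : Prop where
  measurable : ∀ t, Measurable (Z t)
  initial : ∀ᵐ ω ∂P, Z 0 ω = 1
  right_continuous : ∀ ω t, ContinuousWithinAt (fun u => Z u ω) (Set.Ici t) t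
  left_limit : ∀ ω t, 0 < t → ∃ l : ℕ, Tendsto (fun u => Z u ω) (𝓝[<] t) (𝓝 l)
  martingale : ∀ f : ℕ → ℝ, (Function.support f).Finite →
    Martingale
      (fun (t : ℝ≥0) ω =>
        f (Z t ω) - ∫ u in (0 : ℝ)..(t : ℝ), generator θ lam a f u (Z u.toNNReal ω))
      (Filtration.natural Z (fun t => (measurable t).stronglyMeasurable)) P

/-- The mean population size `μ_t = exp (∫₀ᵗ (a_u - 1) lam_u du)`. -/
def μ (lam a : ℝ → ℝ) (t : ℝ) : ℝ :=
  Real.exp (∫ u in (0 : ℝ)..t, (a u - 1) * lam u)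

/-- `V_{t,θ} = θ (1 + θ)⁻¹ ∫₀ᵗ μ_u^(-θ) lam_u du`. -/
def V (θ : ℝ) (lam a : ℝ → ℝ) (t : ℝ) : ℝ :=
  θ / (1 + θ) * ∫ u in (0 : ℝ)..t, μ lam a u ^ (-θ) * lam u

section Conditional

variable {Ω : Type*} [MeasurableSpace Ω]

/-- The conditional law of the scenario given survival, `P(· | Z_t > 0)`. -/
def condAlive (P : Measure Ω) (Z : ℝ≥0 → Ω → ℕ) (t : ℝ≥0) : Measure Ω :=
  ProbabilityTheory.cond P {ω | 0 < Z t ω}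

/-- The survival probability `P(Z_t > 0)`. -/
def survival (P : Measure Ω) (Z : ℝ≥0 → Ω → ℕ) (t : ℝ≥0) : ℝ :=
  P.real {ω | 0 < Z t ω}

/-- The conditional mean `m_t = E(Z_t | Z_t > 0)`, as an element of `[0, ∞]`. -/
def m (P : Measure Ω) (Z : ℝ≥0 → Ω → ℕ) (t : ℝ≥0) : ℝ≥0∞ :=
  ∫⁻ ω, (Z t ω : ℝ≥0∞) ∂(condAlive P Z t)

/-- Loosely subcritical: the extinction probability `q = lim P(Z_t = 0)` is `1`, and `m_t` has no
limit in `[0, ∞]` as `t → ∞`. -/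
def LooselySubcritical (P : Measure Ω) (Z : ℝ≥0 → Ω → ℕ) : Prop :=
  Tendsto (fun t : ℝ≥0 => P {ω | Z t ω = 0}) atTop (𝓝 1) ∧
    ¬ ∃ L : ℝ≥0∞, Tendsto (m P Z) atTop (𝓝 L)

end Conditional

/-- The quantity `μ_t^θ V_{t,θ}`, as an element of `[0, ∞]`. -/
def growth (θ : ℝ) (lam a : ℝ → ℝ) (t : ℝ≥0) : ℝ≥0∞ :=
  ENNReal.ofReal (μ lam a t ^ θ * V θ lam a t)

/-- `w ↦ 1 - (1 + w^(-θ))^(-1/θ)` on `[0, ∞)`, with `0^(-θ) = ∞`, so that the value at `0`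
is `1`. -/
def criticalLaplace (θ w : ℝ) : ℝ :=
  if w = 0 then 1 else 1 - (1 + w ^ (-θ)) ^ (-(1 / θ))

/-- `m = (M + θ (1 + θ)⁻¹)^(1/θ)`. -/
def limitMean (θ M : ℝ) : ℝ := (M + θ / (1 + θ)) ^ (1 / θ)

/-- `s ↦ 1 - m (M - (1 + θ)⁻¹ + (1 - s)^(-θ))^(-1/θ)` on `[0, 1]`, with `0^(-θ) = ∞`, so that the
value at `1` is `1`. -/
def subcriticalPgf (θ M s : ℝ) : ℝ :=
  if s = 1 then 1
  else 1 - limitMean θ M * (M - 1 / (1 + θ) + (1 - s) ^ (-θ)) ^ (-(1 / θ))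

end ThetaBranching

end

noncomputable section

/-! The theta-positive offspring law is chosen so that the generating function of `Z t` can be
computed. Testing the martingale problem on indicators of points and taking expectations gives
Kolmogorov's forward equations (`IsProcess.forward`). Formally the generating function then solves a
first-order linear equation, whose characteristics, in the variable `q = 1 - s`, obey the Bernoulli
equation `q' = λ ((1 - a) q + a q^(1+θ) / (1 + θ))`. The substitution `q^(-θ)` makes it linear, and
its solution (`IsEnvironment.exists_characteristic`) yields `1 - E s^{Z_t} = invPgf^(-1/θ)`
(`IsProcess.pgf`). To avoid differentiating an infinite series, the generating function is truncated
at `N`. Along a characteristic only boundary terms remain, and they vanish geometrically in `N`.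
Since `λ` is merely locally integrable, all derivatives exist only almost everywhere, and absolute
continuity replaces differentiability.

Taking `s = 0` gives the survival probability, and `s → 1` gives `E Z_t = μ_t`. Hence `m_t` equals
`c = condMean`, with `c^θ = θ/(1+θ) + μ^θ (1/(1+θ) + V)`; the survival probability is `μ / c`; and
the conditional generating function depends on the environment through `c` alone.

The rest is calculus. If `V → ∞`, then survival tends to zero, and `c^θ` is `θ/(1+θ)` plus `μ^θ V`
times a factor tending to `1`, so `m_t` and `μ^θ V` have limits together, also along sequences. If
`V` is bounded and extinction is certain, then `μ → 0` and `m_t` converges, which excludes loose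
subcriticality. Compactness of `[0, ∞]` supplies two partial limits of a function without a limit.
-/

/-! ### Calculus of absolutely continuous functions. -/

theorem AbsolutelyContinuousOnInterval.comp_lipschitzOnWith {f g : ℝ → ℝ} {a b : ℝ} {K : ℝ≥0}
    {s : Set ℝ} (hf : AbsolutelyContinuousOnInterval f a b) (hg : LipschitzOnWith K g s)
    (hs : Set.MapsTo f (Set.uIcc a b) s) :
    AbsolutelyContinuousOnInterval (fun x => g (f x)) a b := by
  rw [absolutelyContinuousOnInterval_iff] at hf ⊢
  intro ε hε
  obtain ⟨δ, hδ, h⟩ := hf (ε / (K + 1)) (by positivity)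
  -- Dividing by `K + 1` rather than `K` covers `K = 0`.
  refine ⟨δ, hδ, fun E hE hlen => ?_⟩
  have hE' := h E hE hlen
  calc ∑ i ∈ Finset.range E.1, dist (g (f (E.2 i).1)) (g (f (E.2 i).2))
      ≤ ∑ i ∈ Finset.range E.1, K * dist (f (E.2 i).1) (f (E.2 i).2) := by
        refine Finset.sum_le_sum fun i hi => ?_
        exact hg.dist_le_mul _ (hs (hE.1 i hi).1) _ (hs (hE.1 i hi).2)
    _ = K * ∑ i ∈ Finset.range E.1, dist (f (E.2 i).1) (f (E.2 i).2) := by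
        rw [Finset.mul_sum]
    _ ≤ (K + 1) * ∑ i ∈ Finset.range E.1, dist (f (E.2 i).1) (f (E.2 i).2) := by
        refine mul_le_mul_of_nonneg_right (by simp) (Finset.sum_nonneg fun i _ => dist_nonneg)
    _ < (K + 1) * (ε / (K + 1)) := by gcongr
    _ = ε := by field_simp

/-- The composition of an absolutely continuous function with a function that is continuously
differentiable on an interval containing its range is absolutely continuous. -/
theorem AbsolutelyContinuousOnInterval.comp_contDiffOn {f g : ℝ → ℝ} {a b c d : ℝ}
    (hf : AbsolutelyContinuousOnInterval f a b) (hg : ContDiffOn ℝ 1 g (Set.Icc c d))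
    (hs : Set.MapsTo f (Set.uIcc a b) (Set.Icc c d)) :
    AbsolutelyContinuousOnInterval (fun x => g (f x)) a b := by
  obtain ⟨K, hK⟩ := hg.exists_lipschitzOnWith (by decide) (convex_Icc _ _) isCompact_Icc
  exact hf.comp_lipschitzOnWith hK hs

theorem AbsolutelyContinuousOnInterval.const (c a b : ℝ) :
    AbsolutelyContinuousOnInterval (fun _ : ℝ => c) a b :=
  contDiffOn_const.absolutelyContinuousOnInterval

theorem AbsolutelyContinuousOnInterval.pow {f : ℝ → ℝ} {a b : ℝ}
    (hf : AbsolutelyContinuousOnInterval f a b) (n : ℕ) :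
    AbsolutelyContinuousOnInterval (fun x => f x ^ n) a b := by
  induction n with
  | zero => simpa using AbsolutelyContinuousOnInterval.const 1 a b
  | succ n ih => simpa only [pow_succ] using ih.fun_mul hf

theorem AbsolutelyContinuousOnInterval.sum {ι : Type*} (s : Finset ι) {f : ι → ℝ → ℝ} {a b : ℝ}
    (hf : ∀ i ∈ s, AbsolutelyContinuousOnInterval (f i) a b) :
    AbsolutelyContinuousOnInterval (fun x => ∑ i ∈ s, f i x) a b := by
  classical
  induction s using Finset.induction_on with
  | empty => simpa using AbsolutelyContinuousOnInterval.const 0 a b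
  | insert i s hi ih =>
    simp only [Finset.sum_insert hi]
    exact (hf i (by simp)).fun_add (ih fun j hj => hf j (by simp [hj]))

/-- The fundamental theorem of calculus with an almost everywhere derivative. -/
theorem AbsolutelyContinuousOnInterval.integral_eq_sub_of_ae_hasDerivAt {f f' : ℝ → ℝ} {a b : ℝ}
    (hf : AbsolutelyContinuousOnInterval f a b)
    (h : ∀ᵐ x, x ∈ Set.uIcc a b → HasDerivAt f (f' x) x) :
    ∫ x in a..b, f' x = f b - f a := by
  rw [← hf.integral_deriv_eq_sub]
  refine intervalIntegral.integral_congr_ae ?_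
  filter_upwards [h] with x hx hx'
  exact (hx (Set.uIoc_subset_uIcc hx')).deriv.symm

/-! ### The theta-positive offspring law. -/

namespace ThetaBranching

theorem offspring_nonneg {θ a : ℝ} (hθ0 : 0 < θ) (hθ1 : θ ≤ 1) (ha0 : 0 ≤ a)
    (ha1 : a ≤ 1 + 1 / θ) (k : ℕ) : 0 ≤ offspring θ a k := by
  match k with
  | 0 =>
    have : θ / (1 + θ) * a ≤ θ / (1 + θ) * (1 + 1 / θ) := by gcongr
    have h2 : θ / (1 + θ) * (1 + 1 / θ) = 1 := by field_simp; ring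
    simp only [offspring]; linarith
  | 1 => simp [offspring]
  | n + 2 =>
    simp only [offspring]
    have : 0 ≤ ∏ j ∈ Finset.range n, ((j : ℝ) + 1 - θ) :=
      Finset.prod_nonneg fun j _ => by
        have : (0 : ℝ) ≤ j := Nat.cast_nonneg j
        linarith
    positivity

/-- The first two factors `-(1 + θ)` and `-θ` are negative and their signs cancel; the remaining
ones are those in the definition of `offspring`. -/
theorem ascPochhammer_eval_neg_one_add (θ : ℝ) (n : ℕ) :
    (ascPochhammer ℝ (n + 2)).eval (-(1 + θ)) =
      (1 + θ) * θ * ∏ j ∈ Finset.range n, ((j : ℝ) + 1 - θ) := by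
  induction n with
  | zero => simp [ascPochhammer_succ_eval]; ring
  | succ n ih =>
    rw [show n + 1 + 2 = (n + 2) + 1 by ring, ascPochhammer_succ_eval, ih,
      Finset.prod_range_succ]
    push_cast
    ring

theorem multichoose_neg_one_add (θ : ℝ) (n : ℕ) :
    Ring.multichoose (-(1 + θ)) n = (ascPochhammer ℝ n).eval (-(1 + θ)) / (n.factorial : ℝ) := by
  have h := Ring.factorial_nsmul_multichoose_eq_ascPochhammer (-(1 + θ)) n
  rw [Polynomial.ascPochhammer_smeval_eq_eval, nsmul_eq_mul] at h
  rw [← h]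
  field_simp

/-- The binomial series of `(1 - s)^(1 + θ)`. -/
theorem hasSum_multichoose_neg_one_add (θ : ℝ) {s : ℝ} (hs0 : 0 ≤ s) (hs1 : s < 1) :
    HasSum (fun n : ℕ => Ring.multichoose (-(1 + θ)) n * s ^ n) ((1 - s) ^ (1 + θ)) := by
  have h := (Real.one_div_one_sub_rpow_hasFPowerSeriesOnBall_zero (-(1 + θ))).hasSum
    (y := s) (by simp [enorm_eq_nnnorm, ← NNReal.coe_lt_one, abs_of_nonneg hs0, hs1])
  have h1 : (0 : ℝ) ≤ 1 - s := by linarith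
  rw [zero_add, Real.rpow_neg h1, one_div, inv_inv] at h
  simpa [FormalMultilinearSeries.ofScalars_apply_eq, ← Ring.multichoose_eq, mul_comm] using h

/-- From degree two on, the offspring weights are `a / (1 + θ)` times the binomial coefficients of
`(1 - s)^(1 + θ)`. The affine part of the generating function accounts for degrees zero and one. -/
theorem hasSum_offspring_pow_of_lt_one {θ : ℝ} (hθ0 : 0 < θ) (a : ℝ) {s : ℝ} (hs0 : 0 ≤ s)
    (hs1 : s < 1) :
    HasSum (fun k => offspring θ a k * s ^ k)
      (1 - a * (1 - s) + a / (1 + θ) * (1 - s) ^ (1 + θ)) := by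
  have h := (hasSum_multichoose_neg_one_add θ hs0 hs1).mul_left (a / (1 + θ))
  rw [← hasSum_nat_add_iff' 2] at h ⊢
  convert h using 1
  · funext n
    rw [multichoose_neg_one_add, ascPochhammer_eval_neg_one_add]
    simp only [offspring]
    field_simp
  · simp [Finset.sum_range_succ, offspring]
    field_simp
    ring

/-- Letting `s ↑ 1` bounds the partial sums of the nonnegative weights by `1`, hence summability;
Abel's limit theorem then identifies the sum. -/
theorem hasSum_offspring {θ a : ℝ} (hθ0 : 0 < θ) (hθ1 : θ ≤ 1) (ha0 : 0 ≤ a)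
    (ha1 : a ≤ 1 + 1 / θ) : HasSum (offspring θ a) 1 := by
  have hnn := offspring_nonneg hθ0 hθ1 ha0 ha1
  have hlim : Tendsto (fun s : ℝ => 1 - a * (1 - s) + a / (1 + θ) * (1 - s) ^ (1 + θ))
      (𝓝[<] 1) (𝓝 1) := by
    have : ContinuousAt (fun s : ℝ => 1 - a * (1 - s) + a / (1 + θ) * (1 - s) ^ (1 + θ)) 1 := by
      refine ContinuousAt.add (by fun_prop) (continuousAt_const.mul ?_)
      exact ContinuousAt.rpow_const (by fun_prop) (Or.inr (by linarith))
    have h2 := this.tendsto.mono_left (nhdsWithin_le_nhds (s := Set.Iio 1))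
    simpa [Real.zero_rpow (by linarith : (1 + θ) ≠ 0)] using h2
  have hev : ∀ᶠ s : ℝ in 𝓝[<] 1, 0 ≤ s ∧ s < 1 := by
    filter_upwards [Ico_mem_nhdsLT (zero_lt_one' ℝ)] with s hs using hs
  have hsummable : Summable (offspring θ a) := by
    refine summable_of_sum_range_le (c := 1) hnn fun n => ?_
    have hc : Tendsto (fun s : ℝ => ∑ k ∈ Finset.range n, offspring θ a k * s ^ k) (𝓝[<] 1)
        (𝓝 (∑ k ∈ Finset.range n, offspring θ a k)) := by
      have : Continuous (fun s : ℝ => ∑ k ∈ Finset.range n, offspring θ a k * s ^ k) := by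
        fun_prop
      simpa using (this.tendsto 1).mono_left (nhdsWithin_le_nhds (s := Set.Iio 1))
    refine le_of_tendsto_of_tendsto hc hlim ?_
    filter_upwards [hev] with s hs
    exact sum_le_hasSum _ (fun k _ => mul_nonneg (hnn k) (pow_nonneg hs.1 k))
      (hasSum_offspring_pow_of_lt_one hθ0 a hs.1 hs.2)
  have habel := Real.tendsto_tsum_powerSeries_nhdsWithin_lt hsummable.hasSum.tendsto_sum_nat
  have heq : ∑' k, offspring θ a k = 1 := by
    refine tendsto_nhds_unique habel (hlim.congr' ?_)
    filter_upwards [hev] with s hs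
    exact (hasSum_offspring_pow_of_lt_one hθ0 a hs.1 hs.2).tsum_eq.symm
  exact heq ▸ hsummable.hasSum

end ThetaBranching

/-! ### Joint measurability and Kolmogorov's forward equation. -/

/-- A right-continuous real-time process with values in `ℕ` is jointly measurable. -/
theorem measurable_uncurry_of_rightContinuous {Ω : Type*} [MeasurableSpace Ω]
    {Z : ℝ≥0 → Ω → ℕ} (hm : ∀ t, Measurable (Z t))
    (hr : ∀ ω t, ContinuousWithinAt (fun u => Z u ω) (Set.Ici t) t) :
    Measurable (Function.uncurry Z) := by
  -- The next point of the grid of mesh `1 / (n + 1)` strictly to the right of `t`: it takes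
  -- countably many values and approaches `t` from the right.
  let d : ℕ → ℝ≥0 → ℝ≥0 := fun n t => (⌊t * (n + 1)⌋₊ + 1 : ℝ≥0) / (n + 1)
  have hd : ∀ t, Tendsto (fun n => d n t) atTop (𝓝[≥] t) := by
    intro t
    refine tendsto_nhdsWithin_iff.2 ⟨?_, Eventually.of_forall fun n => ?_⟩
    · have h1 : Tendsto (fun n : ℕ => t + 1 / ((n : ℝ≥0) + 1)) atTop (𝓝 t) := by
        simpa using tendsto_const_nhds.add
          (tendsto_one_div_add_atTop_nhds_zero_nat (𝕜 := ℝ≥0))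
      refine tendsto_of_tendsto_of_tendsto_of_le_of_le tendsto_const_nhds h1 (fun n => ?_)
        (fun n => ?_)
      · simp only [d]
        rw [le_div_iff₀ (by positivity)]
        exact (Nat.lt_floor_add_one _).le
      · simp only [d]
        rw [div_le_iff₀ (by positivity), add_mul, one_div, inv_mul_cancel₀ (by positivity)]
        gcongr
        exact Nat.floor_le (by positivity)
    · simp only [d, Set.mem_Ici]
      rw [le_div_iff₀ (by positivity)]
      exact (Nat.lt_floor_add_one _).le
  have happrox : ∀ n, Measurable fun p : ℝ≥0 × Ω => Z (d n p.1) p.2 := by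
    intro n
    have h1 : Measurable fun q : ℕ × Ω => Z ((q.1 + 1 : ℝ≥0) / (n + 1)) q.2 :=
      measurable_from_prod_countable_right fun k => hm ((k + 1 : ℝ≥0) / (n + 1))
    have h2 : Measurable fun p : ℝ≥0 × Ω => (⌊p.1 * (n + 1)⌋₊, p.2) :=
      (Nat.measurable_floor.comp (measurable_fst.mul_const _)).prodMk measurable_snd
    have h3 := h1.comp h2
    simp only [Function.comp_def] at h3
    exact h3
  refine measurable_of_tendsto_metrizable happrox (tendsto_pi_nhds.2 fun p => ?_)
  exact (hr p.2 p.1).tendsto.comp (hd p.1)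

namespace ThetaBranching

/-- The rate at time `u` of the transition of the population size from `i ≤ j + 1` to `j`. -/
def rate (θ : ℝ) (lam a : ℝ → ℝ) (j i : ℕ) (u : ℝ) : ℝ :=
  i * lam u * (offspring θ (a u) (j + 1 - i) - if i = j then 1 else 0)

theorem generator_single {θ : ℝ} (hθ0 : 0 < θ) (hθ1 : θ ≤ 1) {lam a : ℝ → ℝ}
    (henv : IsEnvironment θ lam a) {u : ℝ} (hu : 0 ≤ u) (j i : ℕ) :
    generator θ lam a (fun n => if n = j then 1 else 0) u i =
      if i < j + 2 then rate θ lam a j i u else 0 := by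
  have hs := hasSum_offspring hθ0 hθ1 (henv.a_nonneg u hu) (henv.a_le u hu)
  -- For `i = 0` the subtraction in `i + k - 1` truncates, but the factor `i` vanishes.
  rcases Nat.eq_zero_or_pos i with rfl | hi
  · simp [generator, rate]
  have h2 : HasSum (fun k => offspring θ (a u) k * (if i + k - 1 = j then (1 : ℝ) else 0))
      (if i < j + 2 then offspring θ (a u) (j + 1 - i) else 0) := by
    split_ifs with h
    · convert hasSum_single (j + 1 - i) (f := fun k => offspring θ (a u) k *
        (if i + k - 1 = j then (1 : ℝ) else 0)) ?_ using 1
      · rw [if_pos (by omega), mul_one]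
      · intro k hk
        rw [if_neg (by omega), mul_zero]
    · convert hasSum_zero using 2 with k
      rw [if_neg (by omega), mul_zero]
  have h3 := h2.sub (hs.mul_right (if i = j then (1 : ℝ) else 0))
  have h4 : ∑' k : ℕ, offspring θ (a u) k *
      ((if i + k - 1 = j then (1 : ℝ) else 0) - (if i = j then 1 else 0)) =
      (if i < j + 2 then offspring θ (a u) (j + 1 - i) else 0) -
        1 * (if i = j then (1 : ℝ) else 0) := by
    rw [← h3.tsum_eq]
    simp only [mul_sub]
  simp only [generator, h4, rate]
  split_ifs <;> first | omega | simp

/-- Affine dependence on `a` reduces measurability of the weights in time to that of `a`. -/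
theorem offspring_eq_add_mul (θ a : ℝ) (k : ℕ) :
    offspring θ a k = offspring θ 0 k + (offspring θ 1 k - offspring θ 0 k) * a := by
  match k with
  | 0 => simp only [offspring]; ring
  | 1 => simp [offspring]
  | n + 2 => simp [offspring]; ring

theorem offspring_le_one {θ a : ℝ} (hθ0 : 0 < θ) (hθ1 : θ ≤ 1) (ha0 : 0 ≤ a)
    (ha1 : a ≤ 1 + 1 / θ) (k : ℕ) : offspring θ a k ≤ 1 := by
  have hs := hasSum_offspring hθ0 hθ1 ha0 ha1
  simpa using le_hasSum hs k fun i _ => offspring_nonneg hθ0 hθ1 ha0 ha1 i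

/-- Multiplication of the death rate by a bounded function of the environment. -/
theorem IsEnvironment.intervalIntegrable_mul {θ : ℝ} {lam a : ℝ → ℝ}
    (henv : IsEnvironment θ lam a) {t : ℝ} (ht : 0 ≤ t) {g : ℝ → ℝ} (hg : Measurable g) {C : ℝ}
    (hC : ∀ u, 0 ≤ u → |g u| ≤ C) :
    IntervalIntegrable (fun u => g u * lam u) volume 0 t := by
  rw [intervalIntegrable_iff_integrableOn_Ioc_of_le ht]
  have h1 := (intervalIntegrable_iff_integrableOn_Ioc_of_le ht).1 (henv.lam_integrable t ht)
  refine Integrable.bdd_mul (c := C) h1 hg.aestronglyMeasurable ?_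
  filter_upwards [ae_restrict_mem measurableSet_Ioc] with u hu
  exact hC u hu.1.le

theorem IsEnvironment.intervalIntegrable_rate {θ : ℝ} (hθ0 : 0 < θ) (hθ1 : θ ≤ 1)
    {lam a : ℝ → ℝ} (henv : IsEnvironment θ lam a) {t : ℝ} (ht : 0 ≤ t) (j i : ℕ) :
    IntervalIntegrable (rate θ lam a j i) volume 0 t := by
  have hg : Measurable fun u => (i : ℝ) *
      (offspring θ (a u) (j + 1 - i) - if i = j then 1 else 0) := by
    simp_rw [fun u => offspring_eq_add_mul θ (a u)]
    have := henv.a_measurable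
    fun_prop
  have h := henv.intervalIntegrable_mul ht hg (C := i) fun u hu => by
    rw [abs_mul, Nat.abs_cast]
    refine mul_le_of_le_one_right (by positivity) ?_
    have h0 := offspring_nonneg hθ0 hθ1 (henv.a_nonneg u hu) (henv.a_le u hu) (j + 1 - i)
    have h1 := offspring_le_one hθ0 hθ1 (henv.a_nonneg u hu) (henv.a_le u hu) (j + 1 - i)
    rw [abs_le]
    split_ifs <;> constructor <;> linarith
  refine h.congr fun u _ => ?_
  simp only [rate]
  ring

section Forward

variable {Ω : Type*} [MeasurableSpace Ω] {P : Measure Ω} {Z : ℝ≥0 → Ω → ℕ}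

/-- The distribution `j ↦ P(Z_t = j)` of the population size at time `t ≥ 0`. -/
def pmass (P : Measure Ω) (Z : ℝ≥0 → Ω → ℕ) (j : ℕ) (t : ℝ) : ℝ :=
  P.real {ω | Z t.toNNReal ω = j}

theorem IsProcess.measurable_indicator {θ : ℝ} {lam a : ℝ → ℝ} (hZ : IsProcess P θ lam a Z)
    (i : ℕ) :
    Measurable fun p : ℝ × Ω => if Z p.1.toNNReal p.2 = i then (1 : ℝ) else 0 := by
  have h := measurable_uncurry_of_rightContinuous hZ.measurable hZ.right_continuous
  have h2 : Measurable fun p : ℝ × Ω => Z p.1.toNNReal p.2 :=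
    h.comp ((measurable_real_toNNReal.comp measurable_fst).prodMk measurable_snd)
  exact Measurable.ite (h2 (measurableSet_singleton i)) measurable_const measurable_const

theorem IsProcess.integral_indicator {θ : ℝ} {lam a : ℝ → ℝ} (hZ : IsProcess P θ lam a Z)
    (i : ℕ) (t : ℝ) :
    ∫ ω, (if Z t.toNNReal ω = i then (1 : ℝ) else 0) ∂P = pmass P Z i t := by
  have hm : MeasurableSet {ω | Z t.toNNReal ω = i} := hZ.measurable _ (measurableSet_singleton i)
  rw [pmass, ← integral_indicator_one hm]
  simp only [Set.indicator_apply, Set.mem_ofPred_eq, Pi.one_apply]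

/-- Kolmogorov's forward equation. -/
theorem IsProcess.forward [IsProbabilityMeasure P] {θ : ℝ} (hθ0 : 0 < θ) (hθ1 : θ ≤ 1)
    {lam a : ℝ → ℝ} (henv : IsEnvironment θ lam a) (hZ : IsProcess P θ lam a Z) (j : ℕ)
    {t : ℝ} (ht : 0 ≤ t) :
    IntervalIntegrable (fun u => ∑ i ∈ Finset.range (j + 2), rate θ lam a j i u * pmass P Z i u)
      volume 0 t ∧
    pmass P Z j t = (if j = 1 then 1 else 0) +
      ∫ u in (0 : ℝ)..t, ∑ i ∈ Finset.range (j + 2), rate θ lam a j i u * pmass P Z i u := by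
  set ν := (volume : Measure ℝ).restrict (Set.Ioc 0 t) with hν
  have hprod : ∀ i, Integrable (fun p : ℝ × Ω => rate θ lam a j i p.1 *
      if Z p.1.toNNReal p.2 = i then (1 : ℝ) else 0) (ν.prod P) := by
    intro i
    have h1 : Integrable (rate θ lam a j i) ν :=
      (intervalIntegrable_iff_integrableOn_Ioc_of_le ht).1
        (henv.intervalIntegrable_rate hθ0 hθ1 ht j i)
    refine Integrable.mul_bdd (c := 1) (h1.comp_fst P)
      (hZ.measurable_indicator i).aestronglyMeasurable (Eventually.of_forall fun p => ?_)
    split_ifs <;> simp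
  have hint : ∀ i, IntervalIntegrable (fun u => rate θ lam a j i u * pmass P Z i u)
      volume 0 t := by
    intro i
    rw [intervalIntegrable_iff_integrableOn_Ioc_of_le ht]
    have h := (hprod i).integral_prod_left
    simp only [integral_const_mul, hZ.integral_indicator] at h
    exact h
  have hfub : ∀ i, ∫ ω, (∫ u in (0 : ℝ)..t, (rate θ lam a j i u *
      if Z u.toNNReal ω = i then (1 : ℝ) else 0)) ∂P =
      ∫ u in (0 : ℝ)..t, rate θ lam a j i u * pmass P Z i u := by
    intro i
    simp only [intervalIntegral.integral_of_le ht]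
    rw [integral_integral_swap]
    · simp only [integral_const_mul, hZ.integral_indicator]
    · exact (hprod i).swap
  have hsec : ∀ᵐ ω ∂P, ∀ i, IntervalIntegrable (fun u => rate θ lam a j i u *
      if Z u.toNNReal ω = i then (1 : ℝ) else 0) volume 0 t := by
    rw [ae_all_iff]
    intro i
    filter_upwards [(hprod i).prod_left_ae] with ω hω
    rwa [intervalIntegrable_iff_integrableOn_Ioc_of_le ht]
  have hsecint : ∀ i, Integrable (fun ω => ∫ u in (0 : ℝ)..t, rate θ lam a j i u *
      if Z u.toNNReal ω = i then (1 : ℝ) else 0) P := by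
    intro i
    simp only [intervalIntegral.integral_of_le ht]
    exact (hprod i).integral_prod_right
  have hsum : IntervalIntegrable (fun u => ∑ i ∈ Finset.range (j + 2),
      rate θ lam a j i u * pmass P Z i u) volume 0 t := by
    simp only [intervalIntegrable_iff_integrableOn_Ioc_of_le ht] at hint ⊢
    exact integrable_finsetSum _ fun i _ => hint i
  refine ⟨hsum, ?_⟩
  -- A jump lowers the population by at most one, so `j` is reached only from `i ≤ j + 1`: the sum
  -- over `i` is finite and no infinite interchange is needed.
  have hmart := hZ.martingale (fun n => if n = j then 1 else 0)
    ((Set.finite_singleton j).subset fun n hn => by simpa using hn)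
  have hE := hmart.setIntegral_eq (zero_le (a := t.toNNReal)) MeasurableSet.univ
  simp only [setIntegral_univ, NNReal.coe_zero, intervalIntegral.integral_same, sub_zero,
    Real.coe_toNNReal t ht] at hE
  have h0 : ∫ ω, (if Z 0 ω = j then (1 : ℝ) else 0) ∂P = if j = 1 then 1 else 0 := by
    rw [integral_congr_ae (g := fun _ => if j = 1 then (1 : ℝ) else 0)]
    · simp
    · filter_upwards [hZ.initial] with ω hω
      simp [hω, eq_comm]
  have hgen : ∀ᵐ ω ∂P, ∫ u in (0 : ℝ)..t, generator θ lam a (fun n => if n = j then 1 else 0) u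
      (Z u.toNNReal ω) = ∑ i ∈ Finset.range (j + 2), ∫ u in (0 : ℝ)..t, (rate θ lam a j i u *
      if Z u.toNNReal ω = i then (1 : ℝ) else 0) := by
    filter_upwards [hsec] with ω hω
    rw [← intervalIntegral.integral_finsetSum fun i _ => hω i]
    refine intervalIntegral.integral_congr fun u hu => ?_
    rw [Set.uIcc_of_le ht] at hu
    simp [generator_single hθ0 hθ1 henv hu.1]
  have hone : Integrable (fun ω => if Z t.toNNReal ω = j then (1 : ℝ) else 0) P := by
    refine Integrable.of_bound (C := 1) ?_ (Eventually.of_forall fun ω => ?_)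
    · exact ((hZ.measurable_indicator j).comp (measurable_prodMk_left (x := t))).aestronglyMeasurable
    · split_ifs <;> simp
  rw [h0, integral_congr_ae (g := fun ω => (if Z t.toNNReal ω = j then (1 : ℝ) else 0) -
      ∑ i ∈ Finset.range (j + 2), ∫ u in (0 : ℝ)..t, (rate θ lam a j i u *
      if Z u.toNNReal ω = i then (1 : ℝ) else 0)) (by
        filter_upwards [hgen] with ω hω
        rw [hω]), integral_sub hone (integrable_finsetSum _ fun i _ => hsecint i),
    integral_finsetSum _ fun i _ => hsecint i, hZ.integral_indicator] at hE
  rw [intervalIntegral.integral_finsetSum fun i _ => hint i, hE]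
  simp only [hfub]
  ring

end Forward
end ThetaBranching

/-! ### The environment functions and the characteristics. -/

/-- An absolutely continuous function with almost everywhere nonpositive derivative is
antitone. -/
theorem AbsolutelyContinuousOnInterval.le_of_ae_hasDerivAt_nonpos {f f' : ℝ → ℝ} {a b u : ℝ}
    (hf : AbsolutelyContinuousOnInterval f a b)
    (h : ∀ᵐ x, x ∈ Set.uIcc a b → HasDerivAt f (f' x) x)
    (h' : ∀ x ∈ Set.Icc a b, f' x ≤ 0) (hu : u ∈ Set.Icc a b) : f b ≤ f u := by
  have hab : a ≤ b := hu.1.trans hu.2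
  have hsub : Set.uIcc u b ⊆ Set.uIcc a b := by
    rw [Set.uIcc_of_le hu.2, Set.uIcc_of_le hab]
    exact Set.Icc_subset_Icc_left hu.1
  have hint := (hf.mono hsub).integral_eq_sub_of_ae_hasDerivAt (f' := f') (by
    filter_upwards [h] with x hx hx' using hx (hsub hx'))
  have : 0 ≤ ∫ x in u..b, -f' x := intervalIntegral.integral_nonneg hu.2 fun x hx => by
    have := h' x ⟨hu.1.trans hx.1, hx.2⟩
    linarith
  rw [intervalIntegral.integral_neg, hint] at this
  linarith

namespace ThetaBranching

variable {θ : ℝ} {lam a : ℝ → ℝ}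

theorem μ_pos (lam a : ℝ → ℝ) (t : ℝ) : 0 < μ lam a t := Real.exp_pos _

theorem μ_zero (lam a : ℝ → ℝ) : μ lam a 0 = 1 := by simp [μ]

theorem V_zero (θ : ℝ) (lam a : ℝ → ℝ) : V θ lam a 0 = 0 := by simp [V]

theorem IsEnvironment.intervalIntegrable_sub_one_mul (henv : IsEnvironment θ lam a)
    {t : ℝ} (ht : 0 ≤ t) : IntervalIntegrable (fun u => (a u - 1) * lam u) volume 0 t := by
  refine henv.intervalIntegrable_mul ht (g := fun u => a u - 1) (C := 1 + 1 / θ + 1)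
    (henv.a_measurable.sub_const 1) fun u hu => ?_
  have h0 := henv.a_nonneg u hu
  have h1 := henv.a_le u hu
  rw [abs_le]
  constructor <;> linarith

theorem IsEnvironment.absolutelyContinuous_μ (henv : IsEnvironment θ lam a) {t : ℝ}
    (ht : 0 ≤ t) : AbsolutelyContinuousOnInterval (μ lam a) 0 t := by
  have h := (henv.intervalIntegrable_sub_one_mul
    ht).absolutelyContinuousOnInterval_intervalIntegral (c := 0) (by simp)
  obtain ⟨C, hC⟩ := h.exists_bound
  exact h.comp_contDiffOn (g := Real.exp) (c := -C) (d := C) Real.contDiff_exp.contDiffOn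
    fun x hx => abs_le.1 (hC x hx)

theorem IsEnvironment.ae_hasDerivAt_μ (henv : IsEnvironment θ lam a) {t : ℝ} (ht : 0 ≤ t) :
    ∀ᵐ u, u ∈ Set.uIcc 0 t → HasDerivAt (μ lam a) (μ lam a u * ((a u - 1) * lam u)) u := by
  filter_upwards [(henv.intervalIntegrable_sub_one_mul ht).ae_hasDerivAt_integral] with u hu hu'
  exact (hu hu' 0 (by simp)).exp

theorem IsEnvironment.continuousOn_μ_rpow (henv : IsEnvironment θ lam a) {t : ℝ} (ht : 0 ≤ t)
    (r : ℝ) : ContinuousOn (fun u => μ lam a u ^ r) (Set.uIcc 0 t) :=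
  (henv.absolutelyContinuous_μ ht).continuousOn.rpow_const fun _ _ => Or.inl (μ_pos _ _ _).ne'

theorem IsEnvironment.intervalIntegrable_μ_rpow_mul (henv : IsEnvironment θ lam a) {t : ℝ}
    (ht : 0 ≤ t) (r : ℝ) : IntervalIntegrable (fun u => μ lam a u ^ r * lam u) volume 0 t :=
  (henv.lam_integrable t ht).continuousOn_mul (henv.continuousOn_μ_rpow ht r)

theorem contDiffOn_rpow_Icc {c d : ℝ} (hc : 0 < c) (r : ℝ) :
    ContDiffOn ℝ 1 (fun y : ℝ => y ^ r) (Set.Icc c d) := fun _ hy =>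
  (Real.contDiffAt_rpow_const (Or.inl (hc.trans_le hy.1).ne')).contDiffWithinAt

theorem absolutelyContinuous_rpow {f : ℝ → ℝ} {b t : ℝ}
    (hf : AbsolutelyContinuousOnInterval f b t) {c : ℝ} (hc : 0 < c)
    (hfc : ∀ u ∈ Set.uIcc b t, c ≤ f u) (r : ℝ) :
    AbsolutelyContinuousOnInterval (fun u => f u ^ r) b t := by
  obtain ⟨C, hC⟩ := hf.exists_bound
  exact hf.comp_contDiffOn (g := fun y => y ^ r) (d := C) (contDiffOn_rpow_Icc hc r)
    fun u hu => ⟨hfc u hu, (le_abs_self _).trans (hC u hu)⟩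

theorem exists_pos_le_of_continuousOn {f : ℝ → ℝ} {b t : ℝ}
    (hf : ContinuousOn f (Set.uIcc b t)) (hpos : ∀ u ∈ Set.uIcc b t, 0 < f u) :
    ∃ c, 0 < c ∧ ∀ u ∈ Set.uIcc b t, c ≤ f u := by
  obtain ⟨u, hu, hmin⟩ := isCompact_uIcc.exists_isMinOn Set.nonempty_uIcc hf
  exact ⟨f u, hpos u hu, fun v hv => hmin hv⟩

theorem IsEnvironment.absolutelyContinuous_μ_rpow (henv : IsEnvironment θ lam a) {t : ℝ}
    (ht : 0 ≤ t) (r : ℝ) : AbsolutelyContinuousOnInterval (fun u => μ lam a u ^ r) 0 t := by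
  have h := henv.absolutelyContinuous_μ ht
  obtain ⟨c, hc, hc'⟩ := exists_pos_le_of_continuousOn h.continuousOn fun u _ => μ_pos lam a u
  exact absolutelyContinuous_rpow h hc hc' r

theorem IsEnvironment.absolutelyContinuous_V (henv : IsEnvironment θ lam a) {t : ℝ}
    (ht : 0 ≤ t) : AbsolutelyContinuousOnInterval (V θ lam a) 0 t :=
  ((henv.intervalIntegrable_μ_rpow_mul ht
    (-θ)).absolutelyContinuousOnInterval_intervalIntegral (c := 0) (by simp)).const_mul _

theorem IsEnvironment.ae_hasDerivAt_V (henv : IsEnvironment θ lam a) {t : ℝ} (ht : 0 ≤ t) :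
    ∀ᵐ u, u ∈ Set.uIcc 0 t →
      HasDerivAt (V θ lam a) (θ / (1 + θ) * (μ lam a u ^ (-θ) * lam u)) u := by
  filter_upwards [(henv.intervalIntegrable_μ_rpow_mul ht (-θ)).ae_hasDerivAt_integral]
    with u hu hu'
  exact (hu hu' 0 (by simp)).const_mul _

theorem IsEnvironment.V_mono (hθ0 : 0 < θ) (henv : IsEnvironment θ lam a) {s t : ℝ}
    (hs : 0 ≤ s) (hst : s ≤ t) : V θ lam a s ≤ V θ lam a t := by
  have hnn : ∀ u, 0 ≤ u → 0 ≤ μ lam a u ^ (-θ) * lam u := fun u hu =>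
    mul_nonneg (Real.rpow_nonneg (μ_pos _ _ _).le _) (henv.lam_nonneg u hu)
  refine mul_le_mul_of_nonneg_left ?_ (by positivity)
  refine intervalIntegral.integral_mono_interval le_rfl hs hst ?_
    (henv.intervalIntegrable_μ_rpow_mul (hs.trans hst) (-θ))
  filter_upwards [ae_restrict_mem measurableSet_Ioc] with u hu using hnn u hu.1.le

theorem IsEnvironment.V_nonneg (hθ0 : 0 < θ) (henv : IsEnvironment θ lam a) {t : ℝ}
    (ht : 0 ≤ t) : 0 ≤ V θ lam a t :=
  (V_zero θ lam a).symm.trans_le (henv.V_mono hθ0 le_rfl ht)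

/-- `(1 - E s^{Z_t})^(-θ)` as a function of `q = 1 - s`. -/
def invPgf (θ : ℝ) (lam a : ℝ → ℝ) (t q : ℝ) : ℝ :=
  μ lam a t ^ (-θ) * (q ^ (-θ) - 1 / (1 + θ)) + 1 / (1 + θ) + V θ lam a t

/-- The characteristic of the equation of the generating function through `(T, s)`. -/
theorem IsEnvironment.exists_characteristic (hθ0 : 0 < θ)
    (henv : IsEnvironment θ lam a) {T s : ℝ} (hT : 0 ≤ T) (hs0 : 0 ≤ s) (hs1 : s < 1) :
    ∃ q : ℝ → ℝ, AbsolutelyContinuousOnInterval q 0 T ∧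
      (∀ᵐ u, u ∈ Set.uIcc 0 T → HasDerivAt q
        (lam u * ((1 - a u) * q u + a u / (1 + θ) * q u ^ (1 + θ))) u) ∧
      (∀ u ∈ Set.uIcc 0 T, 0 < q u ∧ q u ≤ 1) ∧ q T = 1 - s ∧
      q 0 = invPgf θ lam a T (1 - s) ^ (-(1 / θ)) := by
  have hq : 0 < 1 - s := by linarith
  have hθ' : 0 < 1 + θ := by linarith
  let M : ℝ → ℝ := fun u => μ lam a u ^ (-θ)
  have hMpos : ∀ u, 0 < M u := fun u => Real.rpow_pos_of_pos (μ_pos lam a u) _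
  have hMac : AbsolutelyContinuousOnInterval M 0 T := henv.absolutelyContinuous_μ_rpow hT (-θ)
  have hMder : ∀ᵐ u, u ∈ Set.uIcc 0 T → HasDerivAt M (-θ * ((a u - 1) * lam u) * M u) u := by
    filter_upwards [henv.ae_hasDerivAt_μ hT] with u hu hu'
    have h1 := (hu hu').rpow_const (p := -θ) (Or.inl (μ_pos lam a u).ne')
    refine h1.congr_deriv ?_
    have h2 : μ lam a u ^ (-θ) = μ lam a u ^ (-θ - 1) * μ lam a u := by
      rw [← Real.rpow_add_one (μ_pos lam a u).ne', sub_add_cancel]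
    simp only [M, h2]
    ring
  -- This is `μ^(-θ) q^(-θ)`, in which the Bernoulli equation reads `y' = -θ/(1+θ) a λ μ^(-θ)`. The
  -- right side is integrated from `T` backwards through `μ^(-θ)` and `V`.
  let y : ℝ → ℝ := fun u =>
    M T * (1 - s) ^ (-θ) + (1 / (1 + θ) * (M u - M T) + (V θ lam a T - V θ lam a u))
  have hyac : AbsolutelyContinuousOnInterval y 0 T :=
    (AbsolutelyContinuousOnInterval.const _ 0 T).fun_add
      (((hMac.fun_sub (.const _ 0 T)).const_mul _).fun_add
        ((AbsolutelyContinuousOnInterval.const _ 0 T).fun_sub (henv.absolutelyContinuous_V hT)))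
  have hyder : ∀ᵐ u, u ∈ Set.uIcc 0 T →
      HasDerivAt y (-(θ / (1 + θ) * a u * lam u * M u)) u := by
    filter_upwards [hMder, henv.ae_hasDerivAt_V hT] with u h1 h2 hu
    have h3 := ((((h1 hu).sub_const (M T)).const_mul (1 / (1 + θ))).add
      ((h2 hu).const_sub (V θ lam a T))).const_add (M T * (1 - s) ^ (-θ))
    refine h3.congr_deriv ?_
    simp only [M]
    field_simp
    ring
  have hyT : y T = M T * (1 - s) ^ (-θ) := by simp [y]
  have hqθ : 1 ≤ (1 - s) ^ (-θ) :=
    Real.one_le_rpow_of_pos_of_le_one_of_nonpos hq (by linarith) (by linarith)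
  have hy_ge : ∀ u ∈ Set.uIcc 0 T, y T ≤ y u := by
    intro u hu
    rw [Set.uIcc_of_le hT] at hu
    refine hyac.le_of_ae_hasDerivAt_nonpos hyder (fun v hv => ?_) hu
    have := henv.lam_nonneg v hv.1
    have := henv.a_nonneg v hv.1
    have := hMpos v
    simp only [Left.neg_nonpos_iff]
    positivity
  -- Equivalent to `q ≤ 1`. The difference `y - M` is nonincreasing because its derivative is `-θ λ
  -- M` times the probability `1 - θ a / (1 + θ)` of no offspring, and it is nonnegative at `T`.
  have hy_geM : ∀ u ∈ Set.uIcc 0 T, M u ≤ y u := by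
    intro u hu
    rw [Set.uIcc_of_le hT] at hu
    have h := (hyac.fun_sub hMac).le_of_ae_hasDerivAt_nonpos
      (f' := fun u => -(θ / (1 + θ) * a u * lam u * M u) - -θ * ((a u - 1) * lam u) * M u)
      (by filter_upwards [hyder, hMder] with v h1 h2 hv using (h1 hv).sub (h2 hv))
      (fun v hv => ?_) hu
    · have h2 : 0 ≤ M T * ((1 - s) ^ (-θ) - 1) :=
        mul_nonneg (hMpos T).le (by linarith)
      rw [hyT] at h
      linarith
    · have h1 := henv.lam_nonneg v hv.1
      have h2 := henv.a_le v hv.1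
      have h3 := hMpos v
      have h4 : 0 ≤ θ * (1 - θ / (1 + θ) * a v) := by
        refine mul_nonneg hθ0.le ?_
        have : θ / (1 + θ) * a v ≤ θ / (1 + θ) * (1 + 1 / θ) := by gcongr
        have h5 : θ / (1 + θ) * (1 + 1 / θ) = 1 := by field_simp; ring
        linarith
      have h6 := mul_nonneg h4 (mul_nonneg h1 h3.le)
      have h7 : -(θ / (1 + θ) * a v * lam v * M v) - -θ * ((a v - 1) * lam v) * M v =
          -(θ * (1 - θ / (1 + θ) * a v) * (lam v * M v)) := by
        field_simp
        ring
      rw [h7]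
      linarith
  have hyTpos : 0 < y T := by rw [hyT]; have := hMpos T; positivity
  have hypos : ∀ u ∈ Set.uIcc 0 T, 0 < y u := fun u hu => hyTpos.trans_le (hy_ge u hu)
  have hroot : ∀ v : ℝ, 0 < v → (v ^ (-θ)) ^ (-(1 / θ)) = v := by
    intro v hv
    rw [← Real.rpow_mul hv.le, show -θ * -(1 / θ) = 1 by field_simp, Real.rpow_one]
  refine ⟨fun u => μ lam a u ^ (-1 : ℝ) * y u ^ (-(1 / θ)), ?_, ?_, ?_, ?_, ?_⟩
  · exact (henv.absolutelyContinuous_μ_rpow hT (-1)).fun_mul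
      (absolutelyContinuous_rpow hyac hyTpos hy_ge _)
  · filter_upwards [henv.ae_hasDerivAt_μ hT, hyder] with u h1 h2 hu
    have hm := μ_pos lam a u
    have hy := hypos u hu
    have h3 := ((h1 hu).rpow_const (p := -1) (Or.inl hm.ne')).mul
      ((h2 hu).rpow_const (p := -(1 / θ)) (Or.inl hy.ne'))
    refine h3.congr_deriv ?_
    have e1 : μ lam a u ^ ((-1 : ℝ) - 1) = μ lam a u ^ (-1 : ℝ) * (μ lam a u)⁻¹ := by
      rw [Real.rpow_sub_one hm.ne', div_eq_mul_inv]
    have e2 : (μ lam a u ^ (-1 : ℝ) * y u ^ (-(1 / θ))) ^ (1 + θ) =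
        μ lam a u ^ (-1 : ℝ) * M u * y u ^ (-(1 / θ) - 1) := by
      rw [Real.mul_rpow (by positivity) (by positivity), ← Real.rpow_mul hm.le,
        ← Real.rpow_mul hy.le, ← Real.rpow_add hm]
      congr 2
      · ring
      · field_simp
        ring
    simp only [e1, e2]
    field_simp
    ring
  · intro u hu
    have hm := μ_pos lam a u
    have hy := hypos u hu
    refine ⟨by positivity, ?_⟩
    have h1 : y u ^ (-(1 / θ)) ≤ μ lam a u := by
      have := Real.rpow_le_rpow_of_nonpos (hMpos u) (hy_geM u hu)
        (show -(1 / θ) ≤ 0 by simp [hθ0.le])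
      rwa [hroot _ hm] at this
    simp only [Real.rpow_neg_one]
    rwa [inv_mul_le_iff₀ hm, mul_one]
  · simp only [hyT]
    rw [Real.mul_rpow (hMpos T).le (by positivity), hroot _ (μ_pos lam a T), hroot _ hq,
      Real.rpow_neg_one, inv_mul_cancel_left₀ (μ_pos lam a T).ne']
  · simp only [μ_zero, Real.one_rpow, one_mul]
    congr 1
    simp only [y, M, invPgf, μ_zero, V_zero, Real.one_rpow]
    ring

/-! ### The truncated generating function along a characteristic. -/

theorem sum_range_triangle (N : ℕ) (f : ℕ → ℕ → ℝ) :
    ∑ j ∈ Finset.range (N + 1), ∑ i ∈ Finset.range (j + 1), f j i =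
      ∑ i ∈ Finset.range (N + 1), ∑ k ∈ Finset.range (N + 1 - i), f (i + k) i := by
  rw [Finset.sum_comm' (t' := Finset.range (N + 1)) (s' := fun i => Finset.Ico i (N + 1))]
  · exact Finset.sum_congr rfl fun i _ => Finset.sum_Ico_eq_sum_range _ _ _
  · intro j i
    simp only [Finset.mem_range, Finset.mem_Ico]
    omega

/-- The tail of the power series from degree `n` is at most `x ^ n` times the tail mass of `o`. -/
theorem hasSum_pow_sub_sum_mem {o : ℕ → ℝ} {x h : ℝ} (ho : ∀ k, 0 ≤ o k) (ho1 : HasSum o 1)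
    (hx0 : 0 ≤ x) (hx1 : x ≤ 1) (hh : HasSum (fun k => o k * x ^ k) h) (n : ℕ) :
    0 ≤ h - ∑ k ∈ Finset.range n, o k * x ^ k ∧
      h - ∑ k ∈ Finset.range n, o k * x ^ k ≤ x ^ n := by
  constructor
  · rw [sub_nonneg]
    exact sum_le_hasSum _ (fun k _ => mul_nonneg (ho k) (pow_nonneg hx0 k)) hh
  · have h1 := (hasSum_nat_add_iff' n).2 hh
    have h2 := ((hasSum_nat_add_iff' n).2 ho1).mul_right (x ^ n)
    refine (hasSum_le (fun k => ?_) h1 h2).trans ?_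
    · rw [pow_add, ← mul_assoc]
      have : x ^ k ≤ 1 := pow_le_one₀ hx0 hx1
      have h3 := ho (k + n)
      have h4 : o (k + n) * x ^ k ≤ o (k + n) := mul_le_of_le_one_right h3 this
      exact mul_le_mul_of_nonneg_right h4 (pow_nonneg hx0 n)
    · refine mul_le_of_le_one_left (pow_nonneg hx0 n) ?_
      have := Finset.sum_nonneg fun k (_ : k ∈ Finset.range n) => ho k
      linarith

/-- The derivative along a characteristic of the generating function truncated at `N` consists of
boundary terms only. -/
theorem abs_truncated_derivative_le {o p : ℕ → ℝ} {x h l : ℝ} (ho : ∀ k, 0 ≤ o k)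
    (ho1 : HasSum o 1) (hp : ∀ i, 0 ≤ p i) (hp1 : ∀ n, ∑ i ∈ Finset.range n, p i ≤ 1)
    (hx0 : 0 ≤ x) (hx1 : x ≤ 1) (hh : HasSum (fun k => o k * x ^ k) h) (hl : 0 ≤ l) (N : ℕ) :
    |∑ j ∈ Finset.range (N + 1), (j * x ^ (j - 1) * (-(l * (h - x))) * p j +
        x ^ j * ∑ i ∈ Finset.range (j + 2),
          i * l * (o (j + 1 - i) - if i = j then 1 else 0) * p i)| ≤
      (N + 1) * x ^ N * l := by
  -- The loss term `j l p_j` is split off, to cancel the `x` part of the drift `-(l (h - x))`; the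
  -- source state is shifted to `i + 1`, since state zero contributes nothing.
  have hdiag : ∀ j, ∑ i ∈ Finset.range (j + 2),
      (i : ℝ) * l * (o (j + 1 - i) - if i = j then 1 else 0) * p i =
      ∑ i ∈ Finset.range (j + 1), ((i + 1 : ℕ) : ℝ) * l * o (j - i) * p (i + 1) -
        j * l * p j := by
    intro j
    have h1 : ∀ i : ℕ, (i : ℝ) * l * (o (j + 1 - i) - if i = j then 1 else 0) * p i =
        (i : ℝ) * l * o (j + 1 - i) * p i - if i = j then (j : ℝ) * l * p j else 0 := by
      intro i
      split_ifs with hij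
      · subst hij; ring
      · ring
    simp only [h1, Finset.sum_sub_distrib, Finset.sum_ite_eq', Finset.mem_range]
    rw [if_pos (by omega), Finset.sum_range_succ']
    simp
  let S : ℕ → ℝ := fun n => ∑ k ∈ Finset.range n, o k * x ^ k
  have hmain : ∑ j ∈ Finset.range (N + 1), x ^ j * ∑ i ∈ Finset.range (j + 1),
      (((i + 1 : ℕ) : ℝ) * l * o (j - i) * p (i + 1)) =
      ∑ i ∈ Finset.range (N + 1), ((i + 1 : ℕ) : ℝ) * l * p (i + 1) * x ^ i * S (N + 1 - i) := by
    simp only [Finset.mul_sum]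
    rw [sum_range_triangle N fun j i => x ^ j * (((i + 1 : ℕ) : ℝ) * l * o (j - i) * p (i + 1))]
    refine Finset.sum_congr rfl fun i _ => ?_
    simp only [S, Finset.mul_sum]
    refine Finset.sum_congr rfl fun k _ => ?_
    rw [Nat.add_sub_cancel_left, pow_add]
    ring
  have hdrift : ∑ j ∈ Finset.range (N + 1), (j : ℝ) * x ^ (j - 1) * (l * h) * p j =
      ∑ i ∈ Finset.range N, ((i + 1 : ℕ) : ℝ) * l * p (i + 1) * x ^ i * h := by
    rw [Finset.sum_range_succ']
    simp only [Nat.cast_zero, zero_mul, add_zero, Nat.add_sub_cancel]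
    exact Finset.sum_congr rfl fun i _ => by ring
  have hsplit : ∀ j : ℕ, (j : ℝ) * x ^ (j - 1) * (-(l * (h - x))) * p j +
      x ^ j * ∑ i ∈ Finset.range (j + 2),
        (i : ℝ) * l * (o (j + 1 - i) - if i = j then 1 else 0) * p i =
      x ^ j * ∑ i ∈ Finset.range (j + 1), (((i + 1 : ℕ) : ℝ) * l * o (j - i) * p (i + 1)) -
        (j : ℝ) * x ^ (j - 1) * (l * h) * p j := by
    intro j
    rw [hdiag]
    rcases j with _ | j
    · simp
    · rw [Nat.add_sub_cancel, pow_succ]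
      ring
  have hS := hasSum_pow_sub_sum_mem ho ho1 hx0 hx1 hh
  -- Gain and drift differ only by a tail of the offspring series, of size at most `x ^ (N + 1 -
  -- i)`.
  have hterm : ∀ i ∈ Finset.range N, |((i + 1 : ℕ) : ℝ) * l * p (i + 1) * x ^ i *
      (S (N + 1 - i) - h)| ≤ (N + 1) * x ^ N * l * p (i + 1) := by
    intro i hi
    rw [Finset.mem_range] at hi
    have h0 : 0 ≤ ((i + 1 : ℕ) : ℝ) * l * p (i + 1) := by have := hp (i + 1); positivity
    rw [mul_assoc (((i + 1 : ℕ) : ℝ) * l * p (i + 1)), abs_mul, abs_of_nonneg h0, abs_mul,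
      abs_of_nonneg (pow_nonneg hx0 i), abs_sub_comm, abs_of_nonneg (hS _).1]
    have h1 : x ^ i * (h - S (N + 1 - i)) ≤ x ^ N := by
      calc x ^ i * (h - S (N + 1 - i)) ≤ x ^ i * x ^ (N + 1 - i) := by
            gcongr
            exact (hS _).2
        _ = x ^ (N + 1) := by rw [← pow_add]; congr 1; omega
        _ ≤ x ^ N := pow_le_pow_of_le_one hx0 hx1 (by omega)
    have h2 : ((i + 1 : ℕ) : ℝ) ≤ N + 1 := by
      push_cast
      have : (i : ℝ) ≤ N := by exact_mod_cast hi.le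
      linarith
    calc ((i + 1 : ℕ) : ℝ) * l * p (i + 1) * (x ^ i * (h - S (N + 1 - i)))
        ≤ (N + 1) * l * p (i + 1) * x ^ N := by
          have := hp (i + 1)
          have := (hS (N + 1 - i)).1
          gcongr
      _ = (N + 1) * x ^ N * l * p (i + 1) := by ring
  -- State `N + 1` still feeds `N` by a death without offspring, but lies beyond the truncation and
  -- has no drift term to match.
  have hlast : |((N + 1 : ℕ) : ℝ) * l * p (N + 1) * x ^ N * S (N + 1 - N)| ≤
      (N + 1) * x ^ N * l * p (N + 1) := by
    have hp' := hp (N + 1)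
    have ho0 : o 0 ≤ 1 := le_hasSum ho1 0 fun i _ => ho i
    have : S (N + 1 - N) = o 0 := by simp [S]
    rw [this, abs_of_nonneg (by have := ho 0; positivity)]
    calc ((N + 1 : ℕ) : ℝ) * l * p (N + 1) * x ^ N * o 0
        ≤ ((N + 1 : ℕ) : ℝ) * l * p (N + 1) * x ^ N * 1 := by gcongr
      _ = (N + 1) * x ^ N * l * p (N + 1) := by push_cast; ring
  simp only [hsplit, Finset.sum_sub_distrib, hmain, hdrift]
  rw [Finset.sum_range_succ, add_sub_right_comm, ← Finset.sum_sub_distrib]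
  simp only [← mul_sub]
  calc _ ≤ |∑ i ∈ Finset.range N, ((i + 1 : ℕ) : ℝ) * l * p (i + 1) * x ^ i *
          (S (N + 1 - i) - h)| +
        |((N + 1 : ℕ) : ℝ) * l * p (N + 1) * x ^ N * S (N + 1 - N)| := abs_add_le _ _
    _ ≤ ∑ i ∈ Finset.range N, (N + 1) * x ^ N * l * p (i + 1) +
        (N + 1) * x ^ N * l * p (N + 1) :=
      add_le_add ((Finset.abs_sum_le_sum_abs _ _).trans (Finset.sum_le_sum hterm)) hlast
    _ = (N + 1) * x ^ N * l * ∑ i ∈ Finset.range (N + 1), p (i + 1) := by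
      rw [Finset.sum_range_succ, mul_add, Finset.mul_sum]
    _ ≤ (N + 1) * x ^ N * l * 1 := by
      refine mul_le_mul_of_nonneg_left ?_ (by positivity)
      have := hp1 (N + 1 + 1)
      rw [Finset.sum_range_succ'] at this
      linarith [hp 0]
    _ = (N + 1) * x ^ N * l := mul_one _

/-! ### The generating function of the population size. -/

section Pgf

variable {Ω : Type*} [MeasurableSpace Ω] {P : Measure Ω} {Z : ℝ≥0 → Ω → ℕ}

theorem IsProcess.sum_pow_mul_pmass (hZ : IsProcess P θ lam a Z) [IsProbabilityMeasure P]
    (s : ℝ) (t : ℝ) (N : ℕ) :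
    ∑ j ∈ Finset.range N, s ^ j * pmass P Z j t =
      ∫ ω, (if Z t.toNNReal ω < N then s ^ Z t.toNNReal ω else 0) ∂P := by
  have hint : ∀ j, Integrable (fun ω => s ^ j * if Z t.toNNReal ω = j then (1 : ℝ) else 0) P := by
    intro j
    refine Integrable.const_mul (Integrable.of_bound (C := 1) ?_
      (Eventually.of_forall fun ω => ?_)) _
    · exact ((hZ.measurable_indicator j).comp
        (measurable_prodMk_left (x := t))).aestronglyMeasurable
    · split_ifs <;> simp
  simp only [← hZ.integral_indicator, ← integral_const_mul]
  rw [← integral_finsetSum _ fun j _ => hint j]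
  refine integral_congr_ae (Eventually.of_forall fun ω => ?_)
  simp

theorem IsProcess.tendsto_sum_pow_mul_pmass (hZ : IsProcess P θ lam a Z)
    [IsProbabilityMeasure P] {s : ℝ} (hs0 : 0 ≤ s) (hs1 : s ≤ 1) (t : ℝ) :
    Tendsto (fun N => ∑ j ∈ Finset.range (N + 1), s ^ j * pmass P Z j t) atTop
      (𝓝 (∫ ω, s ^ Z t.toNNReal ω ∂P)) := by
  simp only [hZ.sum_pow_mul_pmass]
  refine tendsto_integral_of_dominated_convergence (fun _ => 1) (fun N => ?_)
    (integrable_const 1) (fun N => Eventually.of_forall fun ω => ?_)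
    (Eventually.of_forall fun ω => ?_)
  · have : Measurable fun n : ℕ => if n < N + 1 then s ^ n else 0 := measurable_from_top
    exact (this.comp (hZ.measurable _)).aestronglyMeasurable
  · split_ifs
    · rw [Real.norm_eq_abs, abs_of_nonneg (pow_nonneg hs0 _)]
      exact pow_le_one₀ hs0 hs1
    · simp
  · refine tendsto_const_nhds.congr' ?_
    filter_upwards [eventually_ge_atTop (Z t.toNNReal ω)] with N hN
    rw [if_pos (by omega)]

theorem IsProcess.sum_pmass_le (hZ : IsProcess P θ lam a Z) [IsProbabilityMeasure P]
    (t : ℝ) (N : ℕ) : ∑ j ∈ Finset.range N, pmass P Z j t ≤ 1 := by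
  have h := hZ.sum_pow_mul_pmass 1 t N
  simp only [one_pow, one_mul] at h
  rw [h]
  calc ∫ ω, (if Z t.toNNReal ω < N then (1 : ℝ) else 0) ∂P ≤ ∫ _, (1 : ℝ) ∂P := by
        refine integral_mono_of_nonneg (Eventually.of_forall fun ω => ?_) (integrable_const 1)
          (Eventually.of_forall fun ω => ?_) <;> dsimp only <;> split_ifs <;> simp
    _ = 1 := by simp

/-- The probability generating function of the population size. -/
theorem IsProcess.pgf [IsProbabilityMeasure P] (hθ0 : 0 < θ) (hθ1 : θ ≤ 1)
    (henv : IsEnvironment θ lam a) (hZ : IsProcess P θ lam a Z) (t : ℝ≥0) {s : ℝ}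
    (hs0 : 0 ≤ s) (hs1 : s < 1) :
    ∫ ω, s ^ Z t ω ∂P = 1 - invPgf θ lam a t (1 - s) ^ (-(1 / θ)) := by
  obtain ⟨T, rfl⟩ : ∃ T : ℝ, T.toNNReal = t := ⟨t, Real.toNNReal_coe⟩
  wlog hT : 0 ≤ T generalizing T
  · have := this 0 le_rfl
    rwa [Real.toNNReal_zero, ← Real.toNNReal_of_nonpos (not_le.1 hT).le] at this
  rw [Real.coe_toNNReal T hT]
  obtain ⟨q, hqac, hqder, hq01, hqT, hq0⟩ := henv.exists_characteristic hθ0 hT hs0 hs1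
  -- The uniform bound `1 - q ≤ 1 - c < 1` makes the truncation error `(N + 1) (1 - c)^N ∫ λ`
  -- vanish.
  obtain ⟨c, hc, hcq⟩ := exists_pos_le_of_continuousOn hqac.continuousOn fun u hu => (hq01 u hu).1
  have hc1 : c ≤ 1 := (hcq 0 (by simp)).trans (hq01 0 (by simp)).2
  let D : ℕ → ℝ → ℝ := fun j u =>
    ∑ i ∈ Finset.range (j + 2), rate θ lam a j i u * pmass P Z i u
  -- The integrated form of the forward equation, absolutely continuous by construction and equal to
  -- `pmass` on `[0, T]`.
  let p : ℕ → ℝ → ℝ := fun j t => (if j = 1 then 1 else 0) + ∫ u in (0 : ℝ)..t, D j u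
  have hp : ∀ j, ∀ u ∈ Set.uIcc 0 T, p j u = pmass P Z j u := by
    intro j u hu
    rw [Set.uIcc_of_le hT] at hu
    exact (hZ.forward hθ0 hθ1 henv j hu.1).2.symm
  have hD : ∀ j, IntervalIntegrable (D j) volume 0 T := fun j =>
    (hZ.forward hθ0 hθ1 henv j hT).1
  have hpac : ∀ j, AbsolutelyContinuousOnInterval (p j) 0 T := fun j =>
    (AbsolutelyContinuousOnInterval.const _ 0 T).fun_add
      ((hD j).absolutelyContinuousOnInterval_intervalIntegral (by simp))
  have hpder : ∀ᵐ u, ∀ j, u ∈ Set.uIcc 0 T → HasDerivAt (p j) (D j u) u := by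
    rw [ae_all_iff]
    intro j
    filter_upwards [(hD j).ae_hasDerivAt_integral] with u hu hu'
    exact (hu hu' 0 (by simp)).const_add _
  let x : ℝ → ℝ := fun u => 1 - q u
  have hxac : AbsolutelyContinuousOnInterval x 0 T :=
    (AbsolutelyContinuousOnInterval.const 1 0 T).fun_sub hqac
  let h : ℝ → ℝ := fun u => 1 - a u * (1 - x u) + a u / (1 + θ) * (1 - x u) ^ (1 + θ)
  have hxder : ∀ᵐ u, u ∈ Set.uIcc 0 T → HasDerivAt x (-(lam u * (h u - x u))) u := by
    filter_upwards [hqder] with u hu hu'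
    refine ((hu hu').const_sub 1).congr_deriv ?_
    simp only [h, x, sub_sub_cancel]
    ring
  let G : ℕ → ℝ → ℝ := fun N u => ∑ j ∈ Finset.range (N + 1), x u ^ j * p j u
  let G' : ℕ → ℝ → ℝ := fun N u => ∑ j ∈ Finset.range (N + 1),
    (j * x u ^ (j - 1) * (-(lam u * (h u - x u))) * p j u + x u ^ j * D j u)
  have hGac : ∀ N, AbsolutelyContinuousOnInterval (G N) 0 T := fun N =>
    AbsolutelyContinuousOnInterval.sum _ fun j _ => (hxac.pow j).fun_mul (hpac j)
  have hGder : ∀ N, ∀ᵐ u, u ∈ Set.uIcc 0 T → HasDerivAt (G N) (G' N u) u := by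
    intro N
    filter_upwards [hxder, hpder] with u h1 h2 hu
    exact HasDerivAt.fun_sum fun j _ => ((h1 hu).fun_pow j).fun_mul (h2 j hu)
  have hbound : ∀ N, |G N T - G N 0| ≤ ((N : ℝ) + 1) * (1 - c) ^ N * ∫ u in (0 : ℝ)..T, lam u := by
    intro N
    rw [← (hGac N).integral_eq_sub_of_ae_hasDerivAt (hGder N),
      ← intervalIntegral.integral_const_mul, ← Real.norm_eq_abs]
    refine intervalIntegral.norm_integral_le_of_norm_le hT (Eventually.of_forall fun u hu => ?_)
      ((henv.lam_integrable T hT).const_mul _)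
    have hu0 : 0 ≤ u := hu.1.le
    have hu' : u ∈ Set.uIcc 0 T := by rw [Set.uIcc_of_le hT]; exact ⟨hu0, hu.2⟩
    have hx0 : 0 ≤ x u := sub_nonneg.2 (hq01 u hu').2
    have hx1 : x u < 1 := sub_lt_self 1 (hq01 u hu').1
    have ha0 := henv.a_nonneg u hu0
    have ha1 := henv.a_le u hu0
    have hl := henv.lam_nonneg u hu0
    have key := abs_truncated_derivative_le (offspring_nonneg hθ0 hθ1 ha0 ha1)
      (hasSum_offspring hθ0 hθ1 ha0 ha1) (p := fun i => pmass P Z i u)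
      (fun i => measureReal_nonneg) (hZ.sum_pmass_le u) hx0 hx1.le
      (hasSum_offspring_pow_of_lt_one hθ0 (a u) hx0 hx1) hl N
    refine le_trans (le_of_eq ?_) (key.trans ?_)
    · rw [Real.norm_eq_abs]
      congr 1
      refine Finset.sum_congr rfl fun j _ => ?_
      simp only [hp j u hu', D, rate, h]
    · have : x u ≤ 1 - c := sub_le_sub_left (hcq u hu') 1
      gcongr
  have hlim0 : Tendsto (fun N : ℕ => ((N : ℝ) + 1) * (1 - c) ^ N * ∫ u in (0 : ℝ)..T, lam u)
      atTop (𝓝 0) := by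
    have h1 := tendsto_self_mul_const_pow_of_lt_one (sub_nonneg.2 hc1) (sub_lt_self 1 hc)
    have h2 := tendsto_pow_atTop_nhds_zero_of_lt_one (sub_nonneg.2 hc1) (sub_lt_self 1 hc)
    simpa [add_mul] using (h1.add h2).mul_const (∫ u in (0 : ℝ)..T, lam u)
  have hGT : Tendsto (fun N => G N T) atTop (𝓝 (∫ ω, s ^ Z T.toNNReal ω ∂P)) := by
    refine (hZ.tendsto_sum_pow_mul_pmass hs0 hs1.le T).congr fun N => ?_
    refine Finset.sum_congr rfl fun j _ => ?_
    rw [hp j T (by simp)]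
    simp [x, hqT]
  have hG0 : Tendsto (fun N => G N 0) atTop (𝓝 (x 0)) := by
    refine tendsto_const_nhds.congr' ?_
    filter_upwards [eventually_ge_atTop 1] with N hN
    simp only [G, p, intervalIntegral.integral_same, add_zero, mul_ite, mul_one, mul_zero,
      Finset.sum_ite_eq', Finset.mem_range]
    rw [if_pos (by omega), pow_one]
  have hdiff : Tendsto (fun N => G N T - G N 0) atTop (𝓝 0) :=
    squeeze_zero_norm hbound hlim0
  have := tendsto_nhds_unique (hGT.sub hG0) hdiff
  rw [sub_eq_zero.1 this]
  simp only [x, hq0]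

end Pgf
end ThetaBranching

/-! ### Partial limits along increasing times. -/

theorem exists_strictMono_comp_of_tendsto_atTop {α : Type*} [LinearOrder α] [NoMaxOrder α]
    {t : ℕ → α} (ht : Tendsto t atTop atTop) :
    ∃ φ : ℕ → ℕ, StrictMono φ ∧ StrictMono (t ∘ φ) := by
  obtain ⟨g, hg | hg⟩ := exists_increasing_or_nonincreasing_subseq (· < ·) t
  · exact ⟨g, g.strictMono, fun m n hmn => hg m n hmn⟩
  · exfalso
    have h : Tendsto (t ∘ g) atTop atTop := ht.comp g.strictMono.tendsto_atTop
    obtain ⟨n, hn0, hn⟩ := ((eventually_gt_atTop 0).and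
      (h.eventually_gt_atTop (t (g 0)))).exists
    exact hg 0 n hn0 hn

/-- A cluster point at infinity is a limit along an increasing sequence of times. -/
theorem exists_strictMono_tendsto_of_mapClusterPt {f : ℝ≥0 → ℝ≥0∞} {L : ℝ≥0∞}
    (h : MapClusterPt L atTop f) :
    ∃ t : ℕ → ℝ≥0, StrictMono t ∧ Tendsto t atTop atTop ∧
      Tendsto (fun n => f (t n)) atTop (𝓝 L) := by
  have hne : NeBot (atTop ⊓ comap f (𝓝 L)) :=
    neBot_inf_comap_iff_map.2 (by rw [inf_comm]; exact h)
  obtain ⟨t, ht⟩ := exists_seq_tendsto (atTop ⊓ comap f (𝓝 L))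
  rw [tendsto_inf, tendsto_comap_iff] at ht
  obtain ⟨ht, htL⟩ := ht
  obtain ⟨φ, hφ, htφ⟩ := exists_strictMono_comp_of_tendsto_atTop ht
  exact ⟨t ∘ φ, htφ, ht.comp hφ.tendsto_atTop, htL.comp hφ.tendsto_atTop⟩

/-- By compactness there is a cluster point `M₁`. As it is not the limit, `f` stays outside some
neighbourhood of it at arbitrarily large times, and a cluster point along those times differs from
`M₁`. -/
theorem exists_two_partial_limits {f : ℝ≥0 → ℝ≥0∞}
    (h : ¬ ∃ L : ℝ≥0∞, Tendsto f atTop (𝓝 L)) :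
    ∃ (t₁ t₂ : ℕ → ℝ≥0) (M₁ M₂ : ℝ≥0∞),
      StrictMono t₁ ∧ StrictMono t₂ ∧ Tendsto t₁ atTop atTop ∧ Tendsto t₂ atTop atTop ∧
      M₁ ≠ M₂ ∧ Tendsto (fun n => f (t₁ n)) atTop (𝓝 M₁) ∧
      Tendsto (fun n => f (t₂ n)) atTop (𝓝 M₂) := by
  obtain ⟨M₁, hM₁⟩ := exists_clusterPt_of_compactSpace (map f atTop)
  have hnot : ¬ Tendsto f atTop (𝓝 M₁) := fun h' => h ⟨M₁, h'⟩
  obtain ⟨s, hs, hfreq⟩ := not_tendsto_iff_exists_frequently_notMem.1 hnot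
  have hne : NeBot (atTop ⊓ 𝓟 {x | f x ∉ s}) := frequently_mem_iff_neBot.1 hfreq
  obtain ⟨M₂, hM₂⟩ := exists_clusterPt_of_compactSpace (map f (atTop ⊓ 𝓟 {x | f x ∉ s}))
  have hM : M₁ ≠ M₂ := by
    rintro rfl
    have h1 : sᶜ ∈ map f (atTop ⊓ 𝓟 {x | f x ∉ s}) :=
      mem_map.2 (mem_inf_of_right (mem_principal_self _))
    have h2 : (∅ : Set ℝ≥0∞) ∈ 𝓝 M₁ ⊓ map f (atTop ⊓ 𝓟 {x | f x ∉ s}) :=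
      mem_inf_iff.2 ⟨s, hs, sᶜ, h1, by simp⟩
    exact hM₂.neBot.ne (empty_mem_iff_bot.1 h2)
  have hM₂' : MapClusterPt M₂ atTop f := hM₂.mono (map_mono inf_le_left)
  obtain ⟨t₁, h1, h2, h3⟩ := exists_strictMono_tendsto_of_mapClusterPt (f := f) (L := M₁) hM₁
  obtain ⟨t₂, k1, k2, k3⟩ := exists_strictMono_tendsto_of_mapClusterPt hM₂'
  exact ⟨t₁, t₂, M₁, M₂, h1, k1, h2, k2, hM, h3, k3⟩

/-! ### Closed forms for survival, conditional mean and conditional law. -/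

namespace ThetaBranching

variable {θ : ℝ} {lam a : ℝ → ℝ}

theorem rpow_root (hθ0 : 0 < θ) {c : ℝ} (hc : 0 ≤ c) : (c ^ θ) ^ (1 / θ) = c := by
  rw [← Real.rpow_mul hc, mul_one_div_cancel hθ0.ne', Real.rpow_one]

theorem root_rpow (hθ0 : 0 < θ) {c : ℝ} (hc : 0 ≤ c) : (c ^ (1 / θ)) ^ θ = c := by
  rw [← Real.rpow_mul hc, one_div_mul_cancel hθ0.ne', Real.rpow_one]

theorem IsEnvironment.invPgf_pos (hθ0 : 0 < θ) (henv : IsEnvironment θ lam a) {t q : ℝ}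
    (ht : 0 ≤ t) (hq0 : 0 < q) (hq1 : q ≤ 1) : 0 < invPgf θ lam a t q := by
  have h1 : 1 ≤ q ^ (-θ) := Real.one_le_rpow_of_pos_of_le_one_of_nonpos hq0 hq1 (by linarith)
  have h2 : 1 / (1 + θ) ≤ 1 := by
    rw [div_le_one (by linarith)]
    linarith
  have h3 : 0 ≤ μ lam a t ^ (-θ) * (q ^ (-θ) - 1 / (1 + θ)) :=
    mul_nonneg (Real.rpow_nonneg (μ_pos _ _ _).le _) (by linarith)
  have h4 := henv.V_nonneg hθ0 ht
  have h5 : 0 < 1 / (1 + θ) := by positivity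
  simp only [invPgf]
  linarith

/-- The closed form of the conditional mean of the population size given survival. -/
def condMean (θ : ℝ) (lam a : ℝ → ℝ) (t : ℝ) : ℝ :=
  (θ / (1 + θ) + μ lam a t ^ θ * (1 / (1 + θ) + V θ lam a t)) ^ (1 / θ)

theorem IsEnvironment.condMean_base_pos (hθ0 : 0 < θ) (henv : IsEnvironment θ lam a) {t : ℝ}
    (ht : 0 ≤ t) : 0 < θ / (1 + θ) + μ lam a t ^ θ * (1 / (1 + θ) + V θ lam a t) := by
  have h1 := henv.V_nonneg hθ0 ht
  have h2 := μ_pos lam a t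
  positivity

theorem IsEnvironment.condMean_pos (hθ0 : 0 < θ) (henv : IsEnvironment θ lam a) {t : ℝ}
    (ht : 0 ≤ t) : 0 < condMean θ lam a t :=
  Real.rpow_pos_of_pos (henv.condMean_base_pos hθ0 ht) _

theorem IsEnvironment.condMean_rpow (hθ0 : 0 < θ) (henv : IsEnvironment θ lam a) {t : ℝ}
    (ht : 0 ≤ t) : condMean θ lam a t ^ θ =
      θ / (1 + θ) + μ lam a t ^ θ * (1 / (1 + θ) + V θ lam a t) :=
  root_rpow hθ0 (henv.condMean_base_pos hθ0 ht).le

theorem IsEnvironment.invPgf_eq (hθ0 : 0 < θ) (henv : IsEnvironment θ lam a) {t : ℝ}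
    (ht : 0 ≤ t) (q : ℝ) : invPgf θ lam a t q =
      μ lam a t ^ (-θ) * (condMean θ lam a t ^ θ + (q ^ (-θ) - 1)) := by
  have h : μ lam a t ^ (-θ) * μ lam a t ^ θ = 1 := by
    rw [← Real.rpow_add (μ_pos _ _ _), neg_add_cancel, Real.rpow_zero]
  rw [henv.condMean_rpow hθ0 ht]
  have h2 : 1 / (1 + θ) = 1 - θ / (1 + θ) := by field_simp; ring
  simp only [invPgf]
  linear_combination (-(1 / (1 + θ)) - V θ lam a t) * h - μ lam a t ^ (-θ) * h2

theorem IsEnvironment.invPgf_one_rpow (hθ0 : 0 < θ) (henv : IsEnvironment θ lam a) {t : ℝ}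
    (ht : 0 ≤ t) : invPgf θ lam a t 1 ^ (-(1 / θ)) = μ lam a t / condMean θ lam a t := by
  have hm := μ_pos lam a t
  have hc := henv.condMean_pos hθ0 ht
  rw [henv.invPgf_eq hθ0 ht, Real.one_rpow, sub_self, add_zero, Real.rpow_neg hm.le,
    Real.rpow_neg (by positivity), Real.mul_rpow (by positivity) (by positivity),
    Real.inv_rpow (by positivity), rpow_root hθ0 hm.le, rpow_root hθ0 hc.le]
  field_simp

/-- The difference quotient at `s = 1` of the generating function, whose limit is the mean.
Multiplying the base by `q ^ θ` absorbs the division by `q` and removes the singularity at `q = 0`.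
-/
theorem IsEnvironment.tendsto_invPgf_rpow_div (hθ0 : 0 < θ) (henv : IsEnvironment θ lam a)
    {t : ℝ} (ht : 0 ≤ t) :
    Tendsto (fun q => invPgf θ lam a t q ^ (-(1 / θ)) / q) (𝓝[>] 0) (𝓝 (μ lam a t)) := by
  have hm := μ_pos lam a t
  have hcont : Tendsto (fun q : ℝ => μ lam a t ^ (-θ) * (1 - 1 / (1 + θ) * q ^ θ) +
      (1 / (1 + θ) + V θ lam a t) * q ^ θ) (𝓝 0) (𝓝 (μ lam a t ^ (-θ))) := by
    have h1 : Tendsto (fun q : ℝ => q ^ θ) (𝓝 0) (𝓝 0) := by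
      simpa [Real.zero_rpow hθ0.ne'] using
        (Real.continuousAt_rpow_const 0 θ (Or.inr hθ0.le)).tendsto
    simpa using (((h1.const_mul (1 / (1 + θ))).const_sub 1).const_mul (μ lam a t ^ (-θ))).add
      (h1.const_mul (1 / (1 + θ) + V θ lam a t))
  have h2 := (hcont.mono_left (nhdsWithin_le_nhds (s := Set.Ioi 0))).rpow_const
    (p := -(1 / θ)) (Or.inl (Real.rpow_pos_of_pos hm _).ne')
  rw [← Real.rpow_mul hm.le, show -θ * -(1 / θ) = 1 by field_simp, Real.rpow_one] at h2
  refine h2.congr' ?_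
  filter_upwards [Ioc_mem_nhdsGT (zero_lt_one' ℝ)] with q hq
  have hq0 := hq.1
  have hpos := henv.invPgf_pos hθ0 ht hq.1 hq.2
  have h3 : μ lam a t ^ (-θ) * (1 - 1 / (1 + θ) * q ^ θ) +
      (1 / (1 + θ) + V θ lam a t) * q ^ θ = q ^ θ * invPgf θ lam a t q := by
    have h : q ^ θ * q ^ (-θ) = 1 := by
      rw [← Real.rpow_add hq0, add_neg_cancel, Real.rpow_zero]
    simp only [invPgf]
    linear_combination (-μ lam a t ^ (-θ)) * h
  rw [h3, Real.mul_rpow (by positivity) hpos.le, Real.rpow_neg (by positivity),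
    rpow_root hθ0 hq0.le]
  field_simp

theorem compl_alive {Ω : Type*} (Z : ℝ≥0 → Ω → ℕ) (t : ℝ≥0) : {ω | 0 < Z t ω}ᶜ = {ω | Z t ω = 0} := by
  ext ω
  simp

section Population

variable {Ω : Type*} [MeasurableSpace Ω] {P : Measure Ω} {Z : ℝ≥0 → Ω → ℕ}

theorem IsProcess.measurableSet_alive (hZ : IsProcess P θ lam a Z) (t : ℝ≥0) :
    MeasurableSet {ω | 0 < Z t ω} :=
  hZ.measurable t (measurableSet_Ioi (a := 0))

variable [IsProbabilityMeasure P]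

theorem integrable_pow {X : Ω → ℕ} (hX : Measurable X) {s : ℝ} (hs0 : 0 ≤ s) (hs1 : s ≤ 1) :
    Integrable (fun ω => s ^ X ω) P := by
  refine Integrable.of_bound (C := 1) ?_ (Eventually.of_forall fun ω => ?_)
  · have : Measurable fun n : ℕ => s ^ n := measurable_from_top
    exact (this.comp hX).aestronglyMeasurable
  · rw [Real.norm_eq_abs, abs_of_nonneg (pow_nonneg hs0 _)]
    exact pow_le_one₀ hs0 hs1

theorem IsProcess.survival_eq (hθ0 : 0 < θ) (hθ1 : θ ≤ 1) (henv : IsEnvironment θ lam a)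
    (hZ : IsProcess P θ lam a Z) (t : ℝ≥0) :
    survival P Z t = μ lam a t / condMean θ lam a t := by
  have h := hZ.pgf hθ0 hθ1 henv t le_rfl zero_lt_one
  have hm : MeasurableSet {ω | Z t ω = 0} := hZ.measurable t (measurableSet_singleton 0)
  have h1 : ∫ ω, (0 : ℝ) ^ Z t ω ∂P = P.real {ω | Z t ω = 0} := by
    rw [← integral_indicator_one hm]
    refine integral_congr_ae (Eventually.of_forall fun ω => ?_)
    by_cases hω : Z t ω = 0 <;> simp [hω]
  have h2 := probReal_compl_eq_one_sub (μ := P) (hZ.measurableSet_alive t)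
  rw [compl_alive] at h2
  rw [h1, h2, sub_zero, henv.invPgf_one_rpow hθ0 t.coe_nonneg] at h
  rw [survival]
  linarith

theorem IsProcess.survival_pos (hθ0 : 0 < θ) (hθ1 : θ ≤ 1) (henv : IsEnvironment θ lam a)
    (hZ : IsProcess P θ lam a Z) (t : ℝ≥0) : 0 < survival P Z t := by
  rw [hZ.survival_eq hθ0 hθ1 henv]
  exact div_pos (μ_pos _ _ _) (henv.condMean_pos hθ0 t.coe_nonneg)

/-- `E Z_t = μ_t`. -/
theorem IsProcess.lintegral_eq (hθ0 : 0 < θ) (hθ1 : θ ≤ 1) (henv : IsEnvironment θ lam a)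
    (hZ : IsProcess P θ lam a Z) (t : ℝ≥0) :
    ∫⁻ ω, (Z t ω : ℝ≥0∞) ∂P = ENNReal.ofReal (μ lam a t) := by
  let q : ℕ → ℝ := fun n => 1 / ((n : ℝ) + 1)
  have hq0 : ∀ n, 0 < q n := fun n => Nat.one_div_pos_of_nat
  have hq1 : ∀ n, q n ≤ 1 := fun n => by
    simp only [q]
    rw [div_le_one (by positivity)]
    linarith [Nat.cast_nonneg (α := ℝ) n]
  have hqlim : Tendsto q atTop (𝓝 0) := tendsto_one_div_add_atTop_nhds_zero_nat
  have hqanti : Antitone q := fun m n hmn => Nat.one_div_le_one_div hmn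
  -- As a geometric sum, `(1 - (1 - q)^k) / q` visibly increases to `k` as `q ↓ 0`, so monotone
  -- convergence applies without knowing that the mean is finite.
  let F : ℕ → ℕ → ℝ := fun n k => ∑ i ∈ Finset.range k, (1 - q n) ^ i
  have hF0 : ∀ n k, 0 ≤ F n k := fun n k =>
    Finset.sum_nonneg fun i _ => pow_nonneg (sub_nonneg.2 (hq1 n)) i
  have hFeq : ∀ n k, F n k = (1 - (1 - q n) ^ k) / q n := by
    intro n k
    have h := mul_neg_geom_sum (1 - q n) k
    rw [sub_sub_cancel] at h
    rw [eq_div_iff (hq0 n).ne', mul_comm]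
    exact h
  have hlim1 : Tendsto (fun n => ∫⁻ ω, ENNReal.ofReal (F n (Z t ω)) ∂P) atTop
      (𝓝 (∫⁻ ω, (Z t ω : ℝ≥0∞) ∂P)) := by
    refine lintegral_tendsto_of_tendsto_of_monotone (fun n => ?_)
      (Eventually.of_forall fun ω m n hmn => ?_) (Eventually.of_forall fun ω => ?_)
    · have : Measurable fun k : ℕ => ENNReal.ofReal (F n k) := measurable_from_top
      exact (this.comp (hZ.measurable t)).aemeasurable
    · refine ENNReal.ofReal_le_ofReal (Finset.sum_le_sum fun i _ => ?_)
      exact pow_le_pow_left₀ (sub_nonneg.2 (hq1 m)) (sub_le_sub_left (hqanti hmn) 1) i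
    · rw [← ENNReal.ofReal_natCast]
      refine ENNReal.tendsto_ofReal ?_
      have h := tendsto_finsetSum (Finset.range (Z t ω)) fun i _ =>
        ((tendsto_const_nhds (x := (1 : ℝ))).sub hqlim).pow i
      simpa using h
  have hlim2 : Tendsto (fun n => ∫⁻ ω, ENNReal.ofReal (F n (Z t ω)) ∂P) atTop
      (𝓝 (ENNReal.ofReal (μ lam a t))) := by
    have hq' : Tendsto q atTop (𝓝[>] 0) :=
      tendsto_nhdsWithin_iff.2 ⟨hqlim, Eventually.of_forall hq0⟩
    refine (ENNReal.tendsto_ofReal ((henv.tendsto_invPgf_rpow_div hθ0 t.coe_nonneg).comp hq')).congr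
      fun n => ?_
    have hint := integrable_pow (P := P) (hZ.measurable t) (sub_nonneg.2 (hq1 n))
      (sub_le_self 1 (hq0 n).le)
    rw [← ofReal_integral_eq_lintegral_ofReal _ (Eventually.of_forall fun ω => hF0 n _)]
    · simp only [hFeq]
      rw [integral_div, integral_sub (integrable_const 1) hint,
        hZ.pgf hθ0 hθ1 henv t (sub_nonneg.2 (hq1 n)) (sub_lt_self 1 (hq0 n))]
      simp
    · simp only [hFeq]
      exact ((integrable_const 1).sub hint).div_const _
  exact tendsto_nhds_unique hlim1 hlim2

/-- The event `Z_t = 0` does not contribute to the mean, so the conditional mean is `μ` divided by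
the survival probability `μ / c`. -/
theorem IsProcess.m_eq (hθ0 : 0 < θ) (hθ1 : θ ≤ 1) (henv : IsEnvironment θ lam a)
    (hZ : IsProcess P θ lam a Z) (t : ℝ≥0) :
    m P Z t = ENNReal.ofReal (condMean θ lam a t) := by
  have hs := hZ.survival_pos hθ0 hθ1 henv t
  have hA : P {ω | 0 < Z t ω} = ENNReal.ofReal (survival P Z t) := by
    rw [survival, ofReal_measureReal]
  have h1 : ∫⁻ ω in {ω | 0 < Z t ω}, (Z t ω : ℝ≥0∞) ∂P = ∫⁻ ω, (Z t ω : ℝ≥0∞) ∂P := by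
    refine setLIntegral_eq_of_support_subset fun ω hω => ?_
    simpa [Nat.pos_iff_ne_zero] using hω
  rw [m, condAlive, ProbabilityTheory.cond, lintegral_smul_measure, h1,
    hZ.lintegral_eq hθ0 hθ1 henv, hA, ← ENNReal.ofReal_inv_of_pos hs, smul_eq_mul,
    ← ENNReal.ofReal_mul (inv_nonneg.2 hs.le), hZ.survival_eq hθ0 hθ1 henv]
  have := μ_pos lam a t
  have := henv.condMean_pos hθ0 t.coe_nonneg
  congr 1
  field_simp

theorem IsProcess.isProbabilityMeasure_condAlive (hθ0 : 0 < θ) (hθ1 : θ ≤ 1)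
    (henv : IsEnvironment θ lam a) (hZ : IsProcess P θ lam a Z) (t : ℝ≥0) :
    IsProbabilityMeasure (condAlive P Z t) := by
  refine cond_isProbabilityMeasure fun h => ?_
  have := hZ.survival_pos hθ0 hθ1 henv t
  simp [survival, Measure.real, h] at this

/-- The conditional generating function of the population size given survival. -/
theorem IsProcess.cond_pgf (hθ0 : 0 < θ) (hθ1 : θ ≤ 1) (henv : IsEnvironment θ lam a)
    (hZ : IsProcess P θ lam a Z) (t : ℝ≥0) {s : ℝ} (hs0 : 0 ≤ s) (hs1 : s < 1) :
    ∫ ω, s ^ Z t ω ∂(condAlive P Z t) =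
      1 - (1 + ((1 - s) ^ (-θ) - 1) / condMean θ lam a t ^ θ) ^ (-(1 / θ)) := by
  have hs := hZ.survival_pos hθ0 hθ1 henv t
  have hA : P {ω | 0 < Z t ω} = ENNReal.ofReal (survival P Z t) := by
    rw [survival, ofReal_measureReal]
  have hint := integrable_pow (P := P) (hZ.measurable t) hs0 hs1.le
  have h1 := integral_add_compl (hZ.measurableSet_alive t) hint
  have h2 : ∫ ω in {ω | 0 < Z t ω}ᶜ, s ^ Z t ω ∂P = 1 - survival P Z t := by
    rw [setIntegral_congr_fun (g := fun _ => (1 : ℝ)) (hZ.measurableSet_alive t).compl]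
    · rw [setIntegral_const, probReal_compl_eq_one_sub (hZ.measurableSet_alive t), survival]
      simp
    · intro ω hω
      rw [compl_alive] at hω
      have : Z t ω = 0 := hω
      simp [this]
  rw [h2, hZ.pgf hθ0 hθ1 henv t hs0 hs1] at h1
  have hm := μ_pos lam a t
  have hc := henv.condMean_pos hθ0 t.coe_nonneg
  have hpos : 0 ≤ 1 + ((1 - s) ^ (-θ) - 1) / condMean θ lam a t ^ θ := by
    have : 1 ≤ (1 - s) ^ (-θ) :=
      Real.one_le_rpow_of_pos_of_le_one_of_nonpos (by linarith) (by linarith) (by linarith)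
    have := div_nonneg (sub_nonneg.2 this) (Real.rpow_nonneg hc.le θ)
    linarith
  have h3 : invPgf θ lam a t (1 - s) = invPgf θ lam a t 1 *
      (1 + ((1 - s) ^ (-θ) - 1) / condMean θ lam a t ^ θ) := by
    have : 0 < condMean θ lam a t ^ θ := by positivity
    rw [henv.invPgf_eq hθ0 t.coe_nonneg, henv.invPgf_eq hθ0 t.coe_nonneg, Real.one_rpow]
    field_simp
    ring
  rw [h3, Real.mul_rpow (henv.invPgf_pos hθ0 t.coe_nonneg one_pos le_rfl).le hpos,
    henv.invPgf_one_rpow hθ0 t.coe_nonneg, ← hZ.survival_eq hθ0 hθ1 henv t] at h1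
  rw [condAlive, ProbabilityTheory.cond, integral_smul_measure, hA,
    ← ENNReal.ofReal_inv_of_pos hs, ENNReal.toReal_ofReal (inv_nonneg.2 hs.le), smul_eq_mul,
    eq_sub_of_add_eq h1]
  field_simp
  ring

end Population

/-! ### Conditional mean and growth when `V` tends to infinity. -/

theorem tendsto_correction (hθ0 : 0 < θ) {ι : Type*} {l : Filter ι} {v : ι → ℝ}
    (hv : Tendsto v l atTop) : Tendsto (fun i => 1 / ((1 + θ) * v i) + 1) l (𝓝 1) := by
  have h : Tendsto (fun i => (1 + θ) * v i) l atTop := hv.const_mul_atTop (by linarith)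
  simpa using h.inv_tendsto_atTop.add_const 1

/-- Isolates the growth in `c^θ`; its cofactor tends to `1` as `V → ∞`, so limits in `[0, ∞]`
transfer in both directions. -/
theorem IsEnvironment.condMean_rpow_eq (hθ0 : 0 < θ) (henv : IsEnvironment θ lam a) {t : ℝ≥0}
    (hV : 0 < V θ lam a t) : ENNReal.ofReal (condMean θ lam a t ^ θ) =
      ENNReal.ofReal (θ / (1 + θ)) +
        growth θ lam a t * ENNReal.ofReal (1 / ((1 + θ) * V θ lam a t) + 1) := by
  have hm := μ_pos lam a t
  rw [growth, ← ENNReal.ofReal_mul (by positivity), ← ENNReal.ofReal_add (by positivity)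
    (by positivity), henv.condMean_rpow hθ0 t.coe_nonneg]
  congr 2
  field_simp

theorem IsEnvironment.tendsto_condMean_rpow (hθ0 : 0 < θ) (henv : IsEnvironment θ lam a)
    {ι : Type*} {l : Filter ι} {t : ι → ℝ≥0} {L : ℝ≥0∞}
    (hV : Tendsto (fun i => V θ lam a (t i)) l atTop)
    (hg : Tendsto (fun i => growth θ lam a (t i)) l (𝓝 L)) :
    Tendsto (fun i => ENNReal.ofReal (condMean θ lam a (t i) ^ θ)) l
      (𝓝 (ENNReal.ofReal (θ / (1 + θ)) + L)) := by
  have h1 := ENNReal.tendsto_ofReal (tendsto_correction hθ0 hV)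
  rw [ENNReal.ofReal_one] at h1
  have h2 := ENNReal.Tendsto.mul hg (Or.inr ENNReal.one_ne_top) h1 (Or.inl one_ne_zero)
  rw [mul_one] at h2
  refine (tendsto_const_nhds.add h2).congr' ?_
  filter_upwards [hV.eventually_gt_atTop 0] with i hi
  exact (henv.condMean_rpow_eq hθ0 hi).symm

theorem IsEnvironment.tendsto_growth (hθ0 : 0 < θ) (henv : IsEnvironment θ lam a)
    {ι : Type*} {l : Filter ι} {t : ι → ℝ≥0} {L : ℝ≥0∞}
    (hV : Tendsto (fun i => V θ lam a (t i)) l atTop)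
    (hg : Tendsto (fun i => ENNReal.ofReal (condMean θ lam a (t i) ^ θ)) l (𝓝 L)) :
    Tendsto (fun i => growth θ lam a (t i)) l (𝓝 (L - ENNReal.ofReal (θ / (1 + θ)))) := by
  have h1 := ENNReal.tendsto_ofReal ((tendsto_correction hθ0 hV).inv₀ one_ne_zero)
  rw [inv_one, ENNReal.ofReal_one] at h1
  have h2 := ENNReal.Tendsto.mul
    ((ENNReal.continuous_sub_right (ENNReal.ofReal (θ / (1 + θ)))).tendsto L |>.comp hg)
    (Or.inr ENNReal.one_ne_top) h1 (Or.inl one_ne_zero)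
  rw [mul_one] at h2
  refine h2.congr' ?_
  filter_upwards [hV.eventually_gt_atTop 0] with i hi
  have hpos : 0 < 1 / ((1 + θ) * V θ lam a (t i)) + 1 := by positivity
  simp only [Function.comp_apply]
  rw [henv.condMean_rpow_eq hθ0 hi, ENNReal.add_sub_cancel_left ENNReal.ofReal_ne_top, mul_assoc,
    ← ENNReal.ofReal_mul hpos.le, mul_inv_cancel₀ hpos.ne', ENNReal.ofReal_one, mul_one]

/-- If the growth tends to infinity, then so does the conditional mean. -/
theorem IsEnvironment.tendsto_condMean_atTop (hθ0 : 0 < θ) (henv : IsEnvironment θ lam a)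
    {ι : Type*} {l : Filter ι} {t : ι → ℝ≥0}
    (hV : Tendsto (fun i => V θ lam a (t i)) l atTop)
    (hg : Tendsto (fun i => growth θ lam a (t i)) l (𝓝 ∞)) :
    Tendsto (fun i => condMean θ lam a (t i)) l atTop := by
  have h := henv.tendsto_condMean_rpow hθ0 hV hg
  rw [add_top, ENNReal.tendsto_ofReal_nhds_top] at h
  refine ((tendsto_rpow_atTop (one_div_pos.2 hθ0)).comp h).congr fun i => ?_
  exact rpow_root hθ0 (henv.condMean_pos hθ0 (t i).coe_nonneg).le

theorem IsEnvironment.tendsto_condMean_limitMean (hθ0 : 0 < θ) (henv : IsEnvironment θ lam a)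
    {ι : Type*} {l : Filter ι} {t : ι → ℝ≥0} {M : ℝ} (hM : 0 ≤ M)
    (hV : Tendsto (fun i => V θ lam a (t i)) l atTop)
    (hg : Tendsto (fun i => growth θ lam a (t i)) l (𝓝 (ENNReal.ofReal M))) :
    Tendsto (fun i => condMean θ lam a (t i)) l (𝓝 (limitMean θ M)) := by
  have h := henv.tendsto_condMean_rpow hθ0 hV hg
  rw [← ENNReal.ofReal_add (by positivity) hM] at h
  have h1 := (ENNReal.tendsto_toReal ENNReal.ofReal_ne_top).comp h
  rw [ENNReal.toReal_ofReal (by positivity)] at h1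
  have h2 := h1.rpow_const (p := 1 / θ) (Or.inr (by positivity))
  rw [limitMean, add_comm M]
  refine h2.congr fun i => ?_
  have hc := (henv.condMean_pos hθ0 (t i).coe_nonneg).le
  simp only [Function.comp_apply]
  rw [ENNReal.toReal_ofReal (Real.rpow_nonneg hc _), rpow_root hθ0 hc]

theorem tendsto_V_coe_iff : Tendsto (fun t : ℝ≥0 => V θ lam a t) atTop atTop ↔
    Tendsto (fun t : ℝ => V θ lam a t) atTop atTop := by
  refine ⟨fun h => ?_, fun h => h.comp (NNReal.tendsto_coe_atTop.2 tendsto_id)⟩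
  refine (h.comp tendsto_real_toNNReal_atTop).congr' ?_
  filter_upwards [eventually_ge_atTop 0] with t ht
  simp [Real.coe_toNNReal t ht]

/-! ### Characterization of loose subcriticality. -/

section Population

variable {Ω : Type*} [MeasurableSpace Ω] {P : Measure Ω} [IsProbabilityMeasure P]
  {Z : ℝ≥0 → Ω → ℕ}

theorem IsProcess.tendsto_extinct_iff (hZ : IsProcess P θ lam a Z) :
    Tendsto (fun t : ℝ≥0 => P {ω | Z t ω = 0}) atTop (𝓝 1) ↔
      Tendsto (survival P Z) atTop (𝓝 0) := by
  have h : ∀ t, P {ω | Z t ω = 0} = ENNReal.ofReal (1 - survival P Z t) := by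
    intro t
    rw [survival, ← probReal_compl_eq_one_sub (hZ.measurableSet_alive t), compl_alive,
      ofReal_measureReal]
  have hle : ∀ t, survival P Z t ≤ 1 := fun t => measureReal_le_one
  simp only [h]
  constructor
  · intro h1
    have h2 := ((ENNReal.tendsto_toReal ENNReal.one_ne_top).comp h1).const_sub 1
    rw [ENNReal.toReal_one, sub_self] at h2
    refine h2.congr fun t => ?_
    simp [ENNReal.toReal_ofReal (sub_nonneg.2 (hle t))]
  · intro h1
    simpa using ENNReal.tendsto_ofReal (h1.const_sub 1)

theorem IsProcess.tendsto_survival_zero (hθ0 : 0 < θ) (hθ1 : θ ≤ 1)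
    (henv : IsEnvironment θ lam a) (hZ : IsProcess P θ lam a Z)
    (hV : Tendsto (fun t : ℝ≥0 => V θ lam a t) atTop atTop) :
    Tendsto (survival P Z) atTop (𝓝 0) := by
  have h1 : Tendsto (fun t : ℝ≥0 => V θ lam a t ^ (-(1 / θ))) atTop (𝓝 0) :=
    (tendsto_rpow_neg_atTop (one_div_pos.2 hθ0)).comp hV
  refine tendsto_of_tendsto_of_tendsto_of_le_of_le' tendsto_const_nhds h1
    (Eventually.of_forall fun t => measureReal_nonneg) ?_
  filter_upwards [hV.eventually_gt_atTop 0] with t ht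
  rw [hZ.survival_eq hθ0 hθ1 henv, ← henv.invPgf_one_rpow hθ0 t.coe_nonneg]
  refine Real.rpow_le_rpow_of_nonpos ht ?_ (by simp [hθ0.le])
  have hm := μ_pos lam a t
  have h2 : 1 / (1 + θ) ≤ 1 := by
    rw [div_le_one (by linarith)]
    linarith
  have h3 : 0 ≤ μ lam a t ^ (-θ) * (1 ^ (-θ) - 1 / (1 + θ)) :=
    mul_nonneg (by positivity) (by rw [Real.one_rpow]; linarith)
  have h4 : 0 < 1 / (1 + θ) := by positivity
  simp only [invPgf]
  linarith

/-- If extinction is certain although `V` stays bounded, then the conditional mean converges. -/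
theorem IsProcess.tendsto_m_of_V_le (hθ0 : 0 < θ) (hθ1 : θ ≤ 1)
    (henv : IsEnvironment θ lam a) (hZ : IsProcess P θ lam a Z) {C : ℝ}
    (hC : ∀ t : ℝ≥0, V θ lam a t ≤ C) (hs : Tendsto (survival P Z) atTop (𝓝 0)) :
    Tendsto (m P Z) atTop (𝓝 (ENNReal.ofReal ((θ / (1 + θ)) ^ (1 / θ)))) := by
  have hV0 : ∀ t : ℝ≥0, 0 ≤ V θ lam a t := fun t => henv.V_nonneg hθ0 t.coe_nonneg
  have hC0 : 0 ≤ C := (hV0 0).trans (hC 0)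
  have hk : 0 < θ / (1 + θ) := by positivity
  have hk' : 0 < 1 / (1 + θ) := by positivity
  have hsθ : Tendsto (fun t => survival P Z t ^ θ) atTop (𝓝 0) := by
    simpa [Real.zero_rpow hθ0.ne'] using hs.rpow_const (p := θ) (Or.inr hθ0.le)
  have hidentity : ∀ t : ℝ≥0, μ lam a t ^ θ = survival P Z t ^ θ *
      (θ / (1 + θ) + μ lam a t ^ θ * (1 / (1 + θ) + V θ lam a t)) := by
    intro t
    have hc := henv.condMean_pos hθ0 t.coe_nonneg
    rw [← henv.condMean_rpow hθ0 t.coe_nonneg, hZ.survival_eq hθ0 hθ1 henv,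
      ← Real.mul_rpow (div_nonneg (μ_pos _ _ _).le hc.le) hc.le, div_mul_cancel₀ _ hc.ne']
  -- In `hidentity` the term containing `μ^θ` on the right has a coefficient that is at most `1/2`
  -- once survival is small. Absorbing it on the left bounds `μ^θ` by a multiple of the survival
  -- probability to the power `θ`.
  have hμ : Tendsto (fun t : ℝ≥0 => μ lam a t ^ θ) atTop (𝓝 0) := by
    have hδ : 0 < 1 / (2 * (1 / (1 + θ) + C)) := by positivity
    refine tendsto_of_tendsto_of_tendsto_of_le_of_le' tendsto_const_nhds
      (h := fun t => 2 * (θ / (1 + θ)) * survival P Z t ^ θ) (by simpa using hsθ.const_mul _)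
      (Eventually.of_forall fun t => Real.rpow_nonneg (μ_pos _ _ _).le _) ?_
    filter_upwards [hsθ.eventually_lt_const hδ] with t ht
    have hx : 0 ≤ survival P Z t ^ θ := Real.rpow_nonneg measureReal_nonneg _
    have hy : 0 ≤ μ lam a t ^ θ := Real.rpow_nonneg (μ_pos _ _ _).le _
    rw [lt_div_iff₀ (by positivity)] at ht
    have h1 : survival P Z t ^ θ * (1 / (1 + θ) + V θ lam a t) ≤ 1 / 2 := by
      have : survival P Z t ^ θ * (1 / (1 + θ) + V θ lam a t) ≤
          survival P Z t ^ θ * (1 / (1 + θ) + C) := by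
        gcongr
        exact hC t
      linarith
    have h2 := mul_le_mul_of_nonneg_left h1 hy
    have h3 := hidentity t
    linarith
  have hbase : Tendsto (fun t : ℝ≥0 => θ / (1 + θ) +
      μ lam a t ^ θ * (1 / (1 + θ) + V θ lam a t)) atTop (𝓝 (θ / (1 + θ))) := by
    have h1 : Tendsto (fun t : ℝ≥0 => μ lam a t ^ θ * (1 / (1 + θ) + V θ lam a t)) atTop
        (𝓝 0) := by
      refine squeeze_zero (g := fun t : ℝ≥0 => μ lam a t ^ θ * (1 / (1 + θ) + C))
        (fun t => ?_) (fun t => ?_) (by simpa using hμ.mul_const (1 / (1 + θ) + C))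
      · have := μ_pos lam a t
        have := hV0 t
        positivity
      · have := μ_pos lam a t
        gcongr
        exact hC t
    simpa using h1.const_add (θ / (1 + θ))
  refine (ENNReal.tendsto_ofReal (hbase.rpow_const (p := 1 / θ) (Or.inl hk.ne'))).congr
    fun t => ?_
  rw [hZ.m_eq hθ0 hθ1 henv, condMean]

theorem IsProcess.m_rpow (hθ0 : 0 < θ) (hθ1 : θ ≤ 1) (henv : IsEnvironment θ lam a)
    (hZ : IsProcess P θ lam a Z) (t : ℝ≥0) :
    m P Z t ^ θ = ENNReal.ofReal (condMean θ lam a t ^ θ) := by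
  rw [hZ.m_eq hθ0 hθ1 henv, ENNReal.ofReal_rpow_of_pos (henv.condMean_pos hθ0 t.coe_nonneg)]

theorem IsProcess.exists_tendsto_m_iff (hθ0 : 0 < θ) (hθ1 : θ ≤ 1)
    (henv : IsEnvironment θ lam a) (hZ : IsProcess P θ lam a Z)
    (hV : Tendsto (fun t : ℝ≥0 => V θ lam a t) atTop atTop) :
    (∃ L : ℝ≥0∞, Tendsto (m P Z) atTop (𝓝 L)) ↔
      ∃ L : ℝ≥0∞, Tendsto (growth θ lam a) atTop (𝓝 L) := by
  constructor
  · rintro ⟨L, hL⟩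
    have h1 : Tendsto (fun t => m P Z t ^ θ) atTop (𝓝 (L ^ θ)) :=
      (ENNReal.continuous_rpow_const.tendsto L).comp hL
    simp only [hZ.m_rpow hθ0 hθ1 henv] at h1
    exact ⟨_, henv.tendsto_growth hθ0 hV h1⟩
  · rintro ⟨L, hL⟩
    have h1 := henv.tendsto_condMean_rpow hθ0 hV hL
    simp only [← hZ.m_rpow hθ0 hθ1 henv] at h1
    have h2 := (ENNReal.continuous_rpow_const (y := 1 / θ)).tendsto _ |>.comp h1
    refine ⟨_, h2.congr fun t => ?_⟩
    rw [Function.comp_apply, ← ENNReal.rpow_mul, mul_one_div_cancel hθ0.ne', ENNReal.rpow_one]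

theorem IsProcess.looselySubcritical_iff (hθ0 : 0 < θ) (hθ1 : θ ≤ 1)
    (henv : IsEnvironment θ lam a) (hZ : IsProcess P θ lam a Z) :
    LooselySubcritical P Z ↔ Tendsto (fun t : ℝ => V θ lam a t) atTop atTop ∧
      ¬ ∃ L : ℝ≥0∞, Tendsto (growth θ lam a) atTop (𝓝 L) := by
  rw [LooselySubcritical, hZ.tendsto_extinct_iff, ← tendsto_V_coe_iff]
  constructor
  · rintro ⟨hs, hm⟩
    have hV : Tendsto (fun t : ℝ≥0 => V θ lam a t) atTop atTop := by
      have hmono : Monotone fun t : ℝ≥0 => V θ lam a t := fun s t hst =>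
        henv.V_mono hθ0 s.coe_nonneg hst
      -- `V` is monotone, so it diverges or is bounded; boundedness together with certain extinction
      -- would give `m` a limit.
      rcases tendsto_atTop_of_monotone hmono with h | ⟨C, hC⟩
      · exact h
      · exact absurd ⟨_, hZ.tendsto_m_of_V_le hθ0 hθ1 henv (hmono.ge_of_tendsto hC) hs⟩ hm
    exact ⟨hV, by rwa [← hZ.exists_tendsto_m_iff hθ0 hθ1 henv hV]⟩
  · rintro ⟨hV, hg⟩
    exact ⟨hZ.tendsto_survival_zero hθ0 hθ1 henv hV,
      by rwa [hZ.exists_tendsto_m_iff hθ0 hθ1 henv hV]⟩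

theorem IsProcess.toReal_m (hθ0 : 0 < θ) (hθ1 : θ ≤ 1) (henv : IsEnvironment θ lam a)
    (hZ : IsProcess P θ lam a Z) (t : ℝ≥0) : (m P Z t).toReal = condMean θ lam a t := by
  rw [hZ.m_eq hθ0 hθ1 henv, ENNReal.toReal_ofReal (henv.condMean_pos hθ0 t.coe_nonneg).le]

/-! ### Asymptotics along times with a given limit of the growth. -/

variable {ι : Type*} {l : Filter ι} {t : ι → ℝ≥0}

theorem IsProcess.survival_isEquivalent_of_growth_top (hθ0 : 0 < θ) (hθ1 : θ ≤ 1)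
    (henv : IsEnvironment θ lam a) (hZ : IsProcess P θ lam a Z)
    (hV : Tendsto (fun i => V θ lam a (t i)) l atTop)
    (hg : Tendsto (fun i => growth θ lam a (t i)) l (𝓝 ∞)) :
    (fun i => survival P Z (t i)) ~[l] fun i => V θ lam a (t i) ^ (-(1 / θ)) := by
  refine isEquivalent_of_tendsto_one ?_
  have hg' : Tendsto (fun i => μ lam a (t i) ^ θ * V θ lam a (t i)) l atTop :=
    ENNReal.tendsto_ofReal_nhds_top.1 hg
  -- This base is `invPgf` at `q = 1` divided by `V`.
  have h1 := ((hg'.inv_tendsto_atTop.const_mul (θ / (1 + θ))).add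
    (tendsto_correction hθ0 hV)).rpow_const (p := -(1 / θ)) (Or.inl (by simp))
  rw [mul_zero, zero_add, Real.one_rpow] at h1
  refine h1.congr' ?_
  filter_upwards [hV.eventually_gt_atTop 0] with i hi
  have hm := μ_pos lam a (t i)
  have hpos := henv.invPgf_pos hθ0 (t i).coe_nonneg one_pos le_rfl
  rw [Pi.div_apply, hZ.survival_eq hθ0 hθ1 henv, ← henv.invPgf_one_rpow hθ0 (t i).coe_nonneg,
    ← Real.div_rpow hpos.le hi.le]
  congr 1
  simp only [invPgf, Pi.inv_apply, Real.one_rpow, Real.rpow_neg hm.le]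
  field_simp
  ring

theorem IsProcess.m_isEquivalent_of_growth_top (hθ0 : 0 < θ) (hθ1 : θ ≤ 1)
    (henv : IsEnvironment θ lam a) (hZ : IsProcess P θ lam a Z)
    (hV : Tendsto (fun i => V θ lam a (t i)) l atTop)
    (hg : Tendsto (fun i => growth θ lam a (t i)) l (𝓝 ∞)) :
    (fun i => (m P Z (t i)).toReal) ~[l]
      fun i => μ lam a (t i) * V θ lam a (t i) ^ (1 / θ) := by
  have h := (IsEquivalent.refl (u := fun i => μ lam a (t i)) (l := l)).div
    (hZ.survival_isEquivalent_of_growth_top hθ0 hθ1 henv hV hg)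
  refine (h.congr_left (Eventually.of_forall fun i => ?_)).congr_right ?_
  · have hm := μ_pos lam a (t i)
    have hc := henv.condMean_pos hθ0 (t i).coe_nonneg
    simp only [Pi.div_apply, hZ.toReal_m hθ0 hθ1 henv, hZ.survival_eq hθ0 hθ1 henv]
    field_simp
  · filter_upwards [hV.eventually_gt_atTop 0] with i hi
    simp only [Pi.div_apply, Real.rpow_neg hi.le, div_inv_eq_mul]

/-- The expression is the slope at zero of `x ↦ 1 - exp (-w x)`, with increment `1 / c`. -/
theorem tendsto_mul_one_sub_exp {c : ι → ℝ} (hc : Tendsto c l atTop) (w : ℝ) :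
    Tendsto (fun i => c i * (1 - Real.exp (-w / c i))) l (𝓝 w) := by
  have hd : HasDerivAt (fun x : ℝ => 1 - Real.exp (-w * x)) w 0 := by
    have := (((hasDerivAt_id (0 : ℝ)).const_mul (-w)).exp).const_sub 1
    simpa using this
  have hc' : Tendsto (fun i => (c i)⁻¹) l (𝓝[≠] 0) := by
    refine tendsto_nhdsWithin_iff.2 ⟨hc.inv_tendsto_atTop, ?_⟩
    filter_upwards [hc.eventually_gt_atTop 0] with i hi
    exact inv_ne_zero hi.ne'
  refine (hd.tendsto_slope_zero.comp hc').congr fun i => ?_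
  simp [div_eq_mul_inv]

theorem IsProcess.tendsto_laplace_of_growth_top (hθ0 : 0 < θ) (hθ1 : θ ≤ 1)
    (henv : IsEnvironment θ lam a) (hZ : IsProcess P θ lam a Z)
    (hV : Tendsto (fun i => V θ lam a (t i)) l atTop)
    (hg : Tendsto (fun i => growth θ lam a (t i)) l (𝓝 ∞)) {w : ℝ} (hw : 0 ≤ w) :
    Tendsto (fun i => ∫ ω, Real.exp (-w * (Z (t i) ω : ℝ) / (m P Z (t i)).toReal)
      ∂(condAlive P Z (t i))) l (𝓝 (criticalLaplace θ w)) := by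
  have hprob := hZ.isProbabilityMeasure_condAlive hθ0 hθ1 henv
  -- The case `w = 0` is separate because the real power `0 ^ (-θ)` is `0`, not infinite.
  rcases hw.eq_or_lt with rfl | hw
  · simp [criticalLaplace, tendsto_const_nhds]
  have hc := henv.tendsto_condMean_atTop hθ0 hV hg
  -- With `s = exp (-w / c)`, the term `((1 - s)^(-θ) - 1) / c^θ` of the conditional generating
  -- function is `(c (1 - s))^(-θ) - c^(-θ)`, which tends to `w^(-θ)`.
  have h1 := (tendsto_mul_one_sub_exp hc w).rpow_const (p := -θ) (Or.inl hw.ne')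
  have h2 : Tendsto (fun i => condMean θ lam a (t i) ^ (-θ)) l (𝓝 0) :=
    (tendsto_rpow_neg_atTop hθ0).comp hc
  have h3 := (((h1.sub h2).const_add 1).rpow_const (p := -(1 / θ))
    (Or.inl (by have := Real.rpow_pos_of_pos hw (-θ); linarith))).const_sub 1
  rw [sub_zero] at h3
  rw [criticalLaplace, if_neg hw.ne']
  refine h3.congr fun i => ?_
  have hci := henv.condMean_pos hθ0 (t i).coe_nonneg
  have hs1 : Real.exp (-w / condMean θ lam a (t i)) < 1 :=
    Real.exp_lt_one_iff.2 (div_neg_of_neg_of_pos (by linarith) hci)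
  have hexp : ∀ ω, Real.exp (-w * (Z (t i) ω : ℝ) / (m P Z (t i)).toReal) =
      Real.exp (-w / condMean θ lam a (t i)) ^ Z (t i) ω := by
    intro ω
    rw [← Real.exp_nat_mul, hZ.toReal_m hθ0 hθ1 henv]
    congr 1
    ring
  simp only [hexp]
  rw [hZ.cond_pgf hθ0 hθ1 henv _ (Real.exp_pos _).le hs1,
    Real.mul_rpow hci.le (by linarith), Real.rpow_neg hci.le]
  congr 3
  ring

theorem tendsto_μ_zero_of_growth_finite (hθ0 : 0 < θ) {M : ℝ} (hM : 0 ≤ M)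
    (hV : Tendsto (fun i => V θ lam a (t i)) l atTop)
    (hg : Tendsto (fun i => growth θ lam a (t i)) l (𝓝 (ENNReal.ofReal M))) :
    Tendsto (fun i => μ lam a (t i)) l (𝓝 0) := by
  have h1 := (ENNReal.tendsto_toReal ENNReal.ofReal_ne_top).comp hg
  rw [ENNReal.toReal_ofReal hM] at h1
  -- `μ^θ` is the growth divided by `V`: a bounded quantity over one tending to infinity.
  have h2 := (h1.mul hV.inv_tendsto_atTop).rpow_const (p := 1 / θ) (Or.inr (by positivity))
  rw [mul_zero, Real.zero_rpow (by positivity)] at h2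
  refine h2.congr' ?_
  filter_upwards [hV.eventually_gt_atTop 0] with i hi
  have hm := μ_pos lam a (t i)
  simp only [Function.comp_apply, Pi.inv_apply, growth]
  rw [ENNReal.toReal_ofReal (by positivity), mul_inv_cancel_right₀ hi.ne', rpow_root hθ0 hm.le]

theorem limitMean_pos (hθ0 : 0 < θ) {M : ℝ} (hM : 0 ≤ M) : 0 < limitMean θ M :=
  Real.rpow_pos_of_pos (by positivity) _

theorem IsProcess.survival_isEquivalent_of_growth_finite (hθ0 : 0 < θ) (hθ1 : θ ≤ 1)
    (henv : IsEnvironment θ lam a) (hZ : IsProcess P θ lam a Z) {M : ℝ} (hM : 0 ≤ M)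
    (hV : Tendsto (fun i => V θ lam a (t i)) l atTop)
    (hg : Tendsto (fun i => growth θ lam a (t i)) l (𝓝 (ENNReal.ofReal M))) :
    (fun i => survival P Z (t i)) ~[l] fun i => μ lam a (t i) / limitMean θ M := by
  have h := (IsEquivalent.refl (u := fun i => μ lam a (t i)) (l := l)).div
    ((isEquivalent_const_iff_tendsto (limitMean_pos hθ0 hM).ne').2
      (henv.tendsto_condMean_limitMean hθ0 hM hV hg))
  exact h.congr_left (Eventually.of_forall fun i => (hZ.survival_eq hθ0 hθ1 henv (t i)).symm)

theorem IsProcess.tendsto_pgf_of_growth_finite (hθ0 : 0 < θ) (hθ1 : θ ≤ 1)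
    (henv : IsEnvironment θ lam a) (hZ : IsProcess P θ lam a Z) {M : ℝ} (hM : 0 ≤ M)
    (hV : Tendsto (fun i => V θ lam a (t i)) l atTop)
    (hg : Tendsto (fun i => growth θ lam a (t i)) l (𝓝 (ENNReal.ofReal M)))
    {s : ℝ} (hs0 : 0 ≤ s) (hs1 : s ≤ 1) :
    Tendsto (fun i => ∫ ω, s ^ Z (t i) ω ∂(condAlive P Z (t i))) l
      (𝓝 (subcriticalPgf θ M s)) := by
  have hprob := hZ.isProbabilityMeasure_condAlive hθ0 hθ1 henv
  rcases hs1.eq_or_lt with rfl | hs1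
  · simp [subcriticalPgf, tendsto_const_nhds]
  simp only [hZ.cond_pgf hθ0 hθ1 henv _ hs0 hs1]
  have hb : 0 < M + θ / (1 + θ) := by positivity
  have hroot : limitMean θ M ^ θ = M + θ / (1 + θ) := root_rpow hθ0 hb.le
  have h1 := (henv.tendsto_condMean_limitMean hθ0 hM hV hg).rpow_const (p := θ)
    (Or.inr hθ0.le)
  rw [hroot] at h1
  have hq : 1 ≤ (1 - s) ^ (-θ) :=
    Real.one_le_rpow_of_pos_of_le_one_of_nonpos (by linarith) (by linarith) (by linarith)
  have hbase : 0 < 1 + ((1 - s) ^ (-θ) - 1) / (M + θ / (1 + θ)) := by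
    have := div_nonneg (sub_nonneg.2 hq) hb.le
    linarith
  have h2 := (((tendsto_const_nhds (x := (1 - s) ^ (-θ) - 1)).div h1 hb.ne').const_add
    1).rpow_const (p := -(1 / θ)) (Or.inl hbase.ne')
  rw [subcriticalPgf, if_neg hs1.ne]
  -- Factoring out `M + θ/(1+θ)`, the `θ`-th power of the limiting mean, cancels the prefactor
  -- `limitMean θ M`.
  have h3 : M - 1 / (1 + θ) + (1 - s) ^ (-θ) =
      (M + θ / (1 + θ)) * (1 + ((1 - s) ^ (-θ) - 1) / (M + θ / (1 + θ))) := by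
    rw [mul_add, mul_div_cancel₀ _ hb.ne']
    field_simp
    ring
  rw [h3, Real.mul_rpow hb.le hbase.le, limitMean, ← mul_assoc, ← Real.rpow_add hb,
    add_neg_cancel, Real.rpow_zero, one_mul]
  exact h2.const_sub 1

end Population
end ThetaBranching

end

theorem theorem6 {Ω : Type*} [MeasurableSpace Ω] (P : Measure Ω) [IsProbabilityMeasure P]
    (θ : ℝ) (hθ0 : 0 < θ) (hθ1 : θ ≤ 1) (lam a : ℝ → ℝ)
    (henv : ThetaBranching.IsEnvironment θ lam a)
    (Z : ℝ≥0 → Ω → ℕ) (hZ : ThetaBranching.IsProcess P θ lam a Z) :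
    -- characterization
    (ThetaBranching.LooselySubcritical P Z ↔
      Tendsto (fun t : ℝ => ThetaBranching.V θ lam a t) atTop atTop ∧
        ¬ ∃ L : ℝ≥0∞, Tendsto (ThetaBranching.growth θ lam a) atTop (𝓝 L)) ∧
    (ThetaBranching.LooselySubcritical P Z →
      -- there are sequences of times leading to different partial limits
      (∃ (t₁ t₂ : ℕ → ℝ≥0) (M₁ M₂ : ℝ≥0∞),
        StrictMono t₁ ∧ StrictMono t₂ ∧
        Tendsto t₁ atTop atTop ∧ Tendsto t₂ atTop atTop ∧ M₁ ≠ M₂ ∧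
        Tendsto (fun n => ThetaBranching.growth θ lam a (t₁ n)) atTop (𝓝 M₁) ∧
        Tendsto (fun n => ThetaBranching.growth θ lam a (t₂ n)) atTop (𝓝 M₂)) ∧
      -- infinite partial limit: critical asymptotics along the sequence
      (∀ t : ℕ → ℝ≥0, Tendsto t atTop atTop →
        Tendsto (fun n => ThetaBranching.growth θ lam a (t n)) atTop (𝓝 ∞) →
          (fun n => ThetaBranching.survival P Z (t n)) ~[atTop]
            (fun n => ThetaBranching.V θ lam a (t n) ^ (-(1 / θ))) ∧
          (fun n => (ThetaBranching.m P Z (t n)).toReal) ~[atTop]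
            (fun n => ThetaBranching.μ lam a (t n) * ThetaBranching.V θ lam a (t n) ^ (1 / θ)) ∧
          ∀ w : ℝ, 0 ≤ w →
            Tendsto
              (fun n => ∫ ω, Real.exp (-w * (Z (t n) ω : ℝ) / (ThetaBranching.m P Z (t n)).toReal)
                ∂(ThetaBranching.condAlive P Z (t n)))
              atTop (𝓝 (ThetaBranching.criticalLaplace θ w))) ∧
      -- finite partial limit: strictly subcritical asymptotics along the sequence
      (∀ (t : ℕ → ℝ≥0) (M : ℝ), 0 ≤ M → Tendsto t atTop atTop →
        Tendsto (fun n => ThetaBranching.growth θ lam a (t n)) atTop (𝓝 (ENNReal.ofReal M)) →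
          Tendsto (fun n => ThetaBranching.μ lam a (t n)) atTop (𝓝 0) ∧
          (fun n => ThetaBranching.survival P Z (t n)) ~[atTop]
            (fun n => ThetaBranching.μ lam a (t n) / ThetaBranching.limitMean θ M) ∧
          Tendsto (fun n => ThetaBranching.m P Z (t n)) atTop
            (𝓝 (ENNReal.ofReal (ThetaBranching.limitMean θ M))) ∧
          ∀ s : ℝ, 0 ≤ s → s ≤ 1 →
            Tendsto
              (fun n => ∫ ω, s ^ (Z (t n) ω) ∂(ThetaBranching.condAlive P Z (t n)))
              atTop (𝓝 (ThetaBranching.subcriticalPgf θ M s)))) := by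
  have hchar := hZ.looselySubcritical_iff hθ0 hθ1 henv
  refine ⟨hchar, fun hls => ?_⟩
  obtain ⟨hV, hg⟩ := hchar.1 hls
  have hVt : ∀ t : ℕ → ℝ≥0, Tendsto t atTop atTop →
      Tendsto (fun n => ThetaBranching.V θ lam a (t n)) atTop atTop := fun t ht =>
    (ThetaBranching.tendsto_V_coe_iff.2 hV).comp ht
  refine ⟨exists_two_partial_limits hg, fun t ht htg => ⟨?_, ?_, fun w hw => ?_⟩,
    fun t M hM ht htg => ⟨?_, ?_, ?_, fun s hs0 hs1 => ?_⟩⟩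
  · exact hZ.survival_isEquivalent_of_growth_top hθ0 hθ1 henv (hVt t ht) htg
  · exact hZ.m_isEquivalent_of_growth_top hθ0 hθ1 henv (hVt t ht) htg
  · exact hZ.tendsto_laplace_of_growth_top hθ0 hθ1 henv (hVt t ht) htg hw
  · exact ThetaBranching.tendsto_μ_zero_of_growth_finite hθ0 hM (hVt t ht) htg
  · exact hZ.survival_isEquivalent_of_growth_finite hθ0 hθ1 henv hM (hVt t ht) htg
  · simp only [hZ.m_eq hθ0 hθ1 henv]
    exact ENNReal.tendsto_ofReal (henv.tendsto_condMean_limitMean hθ0 hM (hVt t ht) htg)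
  · exact hZ.tendsto_pgf_of_growth_finite hθ0 hθ1 henv hM (hVt t ht) htg hs0 hs1
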